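/- Let $K$ be an imaginary quadratic extension of $\mathbb{Q}$, with a fixed embedding $K\hookrightarrow\mathbb{C}$, let $N=N_{K/\mathbb{Q}}$ be the norm, and let $\mathcal{N}=\{\beta\in K : N(\beta)=1\}$, which under the embedding is a subset of the unit circle $\mathbb{T}\subset\mathbb{C}$. For $\beta\in K$ let $$H(\beta)=\prod_{v}\max\{1,\|\beta\|_v^{\,n_v/2}\}$$ be the absolute Weil height, where $v$ runs over the places of $K$, $\|\cdot\|_v$ is the absolute value in $v$ that extends the usual (real or $p$-adic) absolute value of $\mathbb{Q}$, and $n_v$ is the local degree of $K$ at $v$. For real $t$ put $\mathcal{H}(t)=\{\beta\in\mathcal{N} : H(\beta)\le t\}$; these sets are finite and increase with $t$. Then $\mathcal{N}$, ordered by $H$, is equidistributed in $\mathbb{T}$: for every continuous function $f:\mathbb{T}\to\mathbb{C}$, $$\lim_{t\to\infty}\frac{1}{\#\mathcal{H}(t)}\sum_{\beta\in\mathcal{H}(t)}f(\beta)=\int_{\mathbb{T}}f\,d\mu,$$ where $\mu$ is the Haar probability measure on $\mathbb{T}$. -/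

import Mathlib

open MeasureTheory NumberField Filter Topology

noncomputable section

/-- The absolute Weil height of an element `β` of a number field `K`.

Mathlib's `Height.mulHeight₁ β` is the product over all places `v` of `K` of
`max 1 ‖β‖_v ^ n_v`, where `‖·‖_v` extends the usual absolute value of `ℚ` below `v` and `n_v` is
the local degree (its finite places already carry the exponent `n_v`, its infinite places are
listed with multiplicity `n_v`).  Taking the root of order `n = [K : ℚ]` gives
`∏ v, max 1 (‖β‖_v ^ (n_v / n))`. -/
def weilHeight {K : Type*} [Field K] [NumberField K] (β : K) : ℝ :=
  Height.mulHeight₁ β ^ ((Module.finrank ℚ K : ℝ)⁻¹)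

/-- The set of elements of `K` of norm one over `ℚ`. -/
def normOneSet (K : Type*) [Field K] [NumberField K] : Set K :=
  {β | Algebra.norm ℚ β = 1}

/-- The elements of norm one whose absolute Weil height is at most `t`. -/
def normOneHeightLE (K : Type*) [Field K] [NumberField K] (t : ℝ) : Set (normOneSet K) :=
  {β | weilHeight (β : K) ≤ t}

/-- Every complex embedding of an imaginary quadratic field maps elements of norm one to the
unit circle. -/
theorem norm_embedding_eq_one_of_mem_normOneSet {K : Type*} [Field K] [NumberField K]
    [Algebra.IsQuadraticExtension ℚ K] [IsTotallyComplex K] (σ : K →+* ℂ)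
    {β : K} (hβ : β ∈ normOneSet K) : ‖σ β‖ = 1 := by
  have h2 : Module.finrank ℚ K = 2 := Algebra.IsQuadraticExtension.finrank_eq_two ℚ K
  have hc : Fintype.card (InfinitePlace K) = 1 := by
    have h := InfinitePlace.sum_mult_eq (K := K)
    simp only [IsTotallyComplex.mult_eq, Finset.sum_const, Finset.card_univ, smul_eq_mul, h2] at h
    omega
  have : Subsingleton (InfinitePlace K) := Fintype.card_le_one_iff_subsingleton.mp hc.le
  have h := InfinitePlace.prod_eq_abs_norm β
  rw [Fintype.prod_subsingleton _ (InfinitePlace.mk σ), IsTotallyComplex.mult_eq,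
    InfinitePlace.apply, show Algebra.norm ℚ β = 1 from hβ] at h
  have hn := norm_nonneg (σ β)
  push_cast at h
  rw [abs_one] at h
  exact (pow_eq_one_iff_of_nonneg hn two_ne_zero).mp h

/-- The inclusion of the elements of norm one of an imaginary quadratic field into the unit
circle, for a chosen embedding of the field into `ℂ`. -/
def normOneToCircle {K : Type*} [Field K] [NumberField K]
    [Algebra.IsQuadraticExtension ℚ K] [IsTotallyComplex K] (σ : K →+* ℂ)
    (β : normOneSet K) : Circle :=
  ⟨σ β, mem_sphere_zero_iff_norm.mpr (norm_embedding_eq_one_of_mem_normOneSet σ β.2)⟩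

/-- The unit circle carries its Borel sigma-algebra. -/
instance instMeasurableSpaceUnitCircle : MeasurableSpace Circle := borel Circle

instance instBorelSpaceUnitCircle : BorelSpace Circle := ⟨rfl⟩

/-- An increasing family of finite subsets of a compact abelian group `T` is equidistributed in
`T` if for every continuous function on `T` the averages over the sets of the family tend to the
integral with respect to the Haar probability measure of `T`
(the Haar measure with total mass one). -/
def IsEquidistributed {ι T : Type*} [Preorder ι] [CommGroup T] [TopologicalSpace T]
    [IsTopologicalGroup T] [CompactSpace T] [MeasurableSpace T] [BorelSpace T]
    (S : ι → Set T) : Prop :=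
  Monotone S ∧ (∀ t, (S t).Finite) ∧
    ∀ f : C(T, ℂ),
      Tendsto (fun t => ((S t).ncard : ℂ)⁻¹ * ∑ᶠ b ∈ S t, f b) atTop
        (𝓝 (∫ x, f x ∂(Measure.haarMeasure (⊤ : TopologicalSpace.PositiveCompacts T))))

end

/-! Write K = ℚ(θ) with θ² = -d and let τ be the image of θ in ℂ. By Hilbert 90 every β of norm one
is (a + bθ)/(a - bθ) with (a, b) ∈ ℤ² primitive, and (a, b) is unique up to sign. On the circle β
becomes z / conj z with z = a + bτ.

The square of the Weil height of β is |z|² φ(a, b), where φ is the finite part of the height of [a +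
bθ : a - bθ] (`mulHeight₁_latticeElt_div`). For primitive (a, b) the larger of the two coordinates
has absolute value at least |2d|_v at each finite v. Truncating every local factor below at |2d|_v
therefore changes nothing at primitive points, and it makes φ a positive function that is periodic
modulo M = 2d and invariant under multiplication by integers prime to M.

It remains to sum f(z / conj z) over primitive points with |z|² φ ≤ T = t². On each residue class
modulo M the sum is a Riemann sum for f(w / conj w) on the unit disc
(`tendsto_inv_mul_tsum_periodic`). Area on the disc pushes forward under w ↦ w / conj w to a
rotation-invariant measure, hence to a multiple of Haar measure. Möbius inversion over m prime to M
passes to primitive points (`exists_tendsto_primitiveSum`), giving κ T ∫ f + o(T) with κ ≠ 0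
independent of f. Dividing by the case f = 1 proves the theorem. -/

/-! ### Riemann sums over shifted square lattices. -/

/-- The coordinatewise floor of a point of the plane. -/
noncomputable def planeFloor (x : ℝ × ℝ) : ℤ × ℤ := (⌊x.1⌋, ⌊x.2⌋)

/-- A lattice point of the plane with integer coordinates, as a point of the plane. -/
noncomputable def latticePoint (z : ℤ × ℤ) : ℝ × ℝ := (z.1, z.2)

theorem measurable_planeFloor : Measurable planeFloor :=
  (Int.measurable_floor.comp measurable_fst).prodMk (Int.measurable_floor.comp measurable_snd)

/-- The fibres of the floor map are unit squares, of area 1. Sums over ℤ² thereby become integrals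
of step functions. -/
theorem map_planeFloor_volume :
    Measure.map planeFloor (volume : Measure (ℝ × ℝ)) = Measure.count := by
  refine Measure.ext_of_singleton fun z => ?_
  rw [Measure.map_apply measurable_planeFloor (measurableSet_singleton z),
    Measure.count_singleton]
  have h : planeFloor ⁻¹' {z} =
      Set.Ico (z.1 : ℝ) (z.1 + 1) ×ˢ Set.Ico (z.2 : ℝ) (z.2 + 1) := by
    ext x
    simp [planeFloor, Prod.ext_iff, Int.floor_eq_iff]
  rw [h, Measure.volume_eq_prod, Measure.prod_prod]
  simp

theorem integral_comp_planeFloor {G : ℤ × ℤ → ℂ} (hG : G.HasFiniteSupport) :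
    ∫ x : ℝ × ℝ, G (planeFloor x) = ∑' z, G z := by
  rw [← integral_map (f := G) measurable_planeFloor.aemeasurable
    (Measurable.of_discrete.aestronglyMeasurable), map_planeFloor_volume, integral_countable]
  · simp [Measure.real]
  · rw [integrable_count_iff]
    refine summable_of_hasFiniteSupport ?_
    exact hG.subset fun z hz => by simpa using hz

theorem norm_latticePoint_planeFloor_sub_le (x : ℝ × ℝ) :
    ‖latticePoint (planeFloor x) - x‖ ≤ 1 := by
  rw [Prod.norm_def]
  refine max_le ?_ ?_ <;>
  · simp only [latticePoint, planeFloor, Prod.fst_sub, Prod.snd_sub, Real.norm_eq_abs]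
    rw [abs_sub_comm, abs_of_nonneg (Int.fract_nonneg _)]
    exact (Int.fract_lt_one _).le

theorem finite_setOf_norm_latticePoint_le (R : ℝ) : {z : ℤ × ℤ | ‖latticePoint z‖ ≤ R}.Finite := by
  refine ((Set.finite_Icc (-⌊R⌋) ⌊R⌋).prod (Set.finite_Icc (-⌊R⌋) ⌊R⌋)).subset fun z hz => ?_
  have h : ∀ n : ℤ, ‖(n : ℝ)‖ ≤ R → n ∈ Set.Icc (-⌊R⌋) ⌊R⌋ := fun n hn => by
    have h2 : |n| ≤ ⌊R⌋ := by
      rw [Int.le_floor]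
      simpa using hn
    exact abs_le.mp h2
  exact ⟨h _ ((norm_fst_le (latticePoint z)).trans hz), h _ ((norm_snd_le (latticePoint z)).trans hz)⟩

theorem hasFiniteSupport_comp_latticePoint {F : ℝ × ℝ → ℂ} {R : ℝ}
    (hF : ∀ x, R < ‖x‖ → F x = 0) (p : ℝ × ℝ) {ε : ℝ} (hε : 0 < ε) :
    (fun z => F (ε • (latticePoint z + p))).HasFiniteSupport := by
  refine (finite_setOf_norm_latticePoint_le (R / ε + ‖p‖)).subset fun z hz => ?_
  have h1 : ‖ε • (latticePoint z + p)‖ ≤ R := not_lt.mp fun h => hz (hF _ h)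
  rw [norm_smul, Real.norm_of_nonneg hε.le] at h1
  have h2 : ‖latticePoint z + p‖ ≤ R / ε := by
    rw [le_div_iff₀ hε]
    linarith
  have h3 := norm_sub_le (latticePoint z + p) p
  rw [add_sub_cancel_right] at h3
  simp only [Set.mem_ofPred_eq]
  linarith

theorem sq_smul_tsum_latticePoint_eq_integral {F : ℝ × ℝ → ℂ} {R : ℝ}
    (hF : ∀ x, R < ‖x‖ → F x = 0) (p : ℝ × ℝ) {ε : ℝ} (hε : 0 < ε) :
    ((ε ^ 2 : ℝ) : ℂ) * ∑' z, F (ε • (latticePoint z + p)) =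
      ∫ x : ℝ × ℝ, F (ε • (latticePoint (planeFloor (ε⁻¹ • x)) + p)) := by
  rw [Measure.integral_comp_smul volume
    (fun y => F (ε • (latticePoint (planeFloor y) + p))) ε⁻¹,
    integral_comp_planeFloor (hasFiniteSupport_comp_latticePoint hF p hε)]
  have h : Module.finrank ℝ (ℝ × ℝ) = 2 := by simp
  rw [h, ← inv_pow, inv_inv, abs_of_nonneg (by positivity), Complex.real_smul]

/-- Riemann sums over a shifted square lattice converge to the integral. -/
theorem tendsto_sq_smul_tsum_latticePoint {F : ℝ × ℝ → ℂ} {R C : ℝ}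
    (hF : ∀ x, R < ‖x‖ → F x = 0) (hC : ∀ x, ‖F x‖ ≤ C) (hcont : ∀ᵐ x, ContinuousAt F x)
    (p : ℝ × ℝ) :
    Tendsto (fun ε : ℝ => ((ε ^ 2 : ℝ) : ℂ) * ∑' z, F (ε • (latticePoint z + p))) (𝓝[>] 0)
      (𝓝 (∫ x, F x)) := by
  have hdist : ∀ {ε : ℝ}, 0 < ε → ∀ x : ℝ × ℝ,
      ‖ε • (latticePoint (planeFloor (ε⁻¹ • x)) + p) - x‖ ≤ ε * (1 + ‖p‖) := by
    intro ε hε x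
    have h1 : ε • (latticePoint (planeFloor (ε⁻¹ • x)) + p) - x =
        ε • ((latticePoint (planeFloor (ε⁻¹ • x)) - ε⁻¹ • x) + p) := by
      rw [smul_add, smul_add, smul_sub, smul_inv_smul₀ hε.ne']
      abel
    rw [h1, norm_smul, Real.norm_of_nonneg hε.le]
    gcongr
    exact (norm_add_le _ _).trans (by gcongr; exact norm_latticePoint_planeFloor_sub_le _)
  have hC0 : 0 ≤ C := (norm_nonneg _).trans (hC 0)
  have hlim : Tendsto (fun ε : ℝ => ε * (1 + ‖p‖)) (𝓝[>] 0) (𝓝 0) := by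
    have : Tendsto (fun ε : ℝ => ε * (1 + ‖p‖)) (𝓝 0) (𝓝 (0 * (1 + ‖p‖))) :=
      tendsto_id.mul_const _
    rw [zero_mul] at this
    exact this.mono_left nhdsWithin_le_nhds
  have hmem : ∀ᶠ ε : ℝ in 𝓝[>] 0, 0 < ε := self_mem_nhdsWithin
  have hmem1 : ∀ᶠ ε : ℝ in 𝓝[>] 0, ε * (1 + ‖p‖) ≤ 1 :=
    (hlim.eventually_lt_const zero_lt_one).mono fun _ h => h.le
  refine Tendsto.congr' (hmem.mono fun ε hε =>
    (sq_smul_tsum_latticePoint_eq_integral hF p hε).symm) ?_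
  -- Once ε(1 + ‖p‖) ≤ 1, the sample point lies within 1 of x, so the integrand vanishes outside the
  -- ball of radius R + 1.
  refine tendsto_integral_filter_of_dominated_convergence
    ((Metric.closedBall (0 : ℝ × ℝ) (R + 1)).indicator fun _ => C) ?_ ?_ ?_ ?_
  · refine Eventually.of_forall fun ε => Measurable.aestronglyMeasurable ?_
    exact (Measurable.of_discrete (f := fun z => F (ε • (latticePoint z + p)))).comp
      (measurable_planeFloor.comp (measurable_const_smul ε⁻¹))
  · filter_upwards [hmem, hmem1] with ε hε hε1
    refine Eventually.of_forall fun x => ?_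
    by_cases hx : x ∈ Metric.closedBall (0 : ℝ × ℝ) (R + 1)
    · rw [Set.indicator_of_mem hx]
      exact hC _
    · rw [Set.indicator_of_notMem hx, hF, norm_zero]
      rw [mem_closedBall_zero_iff, not_le] at hx
      have h1 := hdist hε x
      have h2 := norm_sub_norm_le x (ε • (latticePoint (planeFloor (ε⁻¹ • x)) + p))
      rw [norm_sub_rev] at h2
      linarith
  · rw [integrable_indicator_iff measurableSet_closedBall]
    exact integrableOn_const (measure_closedBall_lt_top.ne)
  · filter_upwards [hcont] with x hx
    refine hx.tendsto.comp ?_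
    rw [tendsto_iff_norm_sub_tendsto_zero]
    refine squeeze_zero' (Eventually.of_forall fun _ => norm_nonneg _) ?_ hlim
    filter_upwards [hmem] with ε hε using hdist hε x

/-! ### The map z ↦ z / conj z and Haar measure on the circle. -/

/-- The point `z / conj z` of the unit circle, with value `1` at `z = 0`. -/
noncomputable def divConj (z : ℂ) : Circle :=
  if h : z = 0 then 1 else (Circle.ofConjDivSelf z h)⁻¹

theorem coe_divConj {z : ℂ} (hz : z ≠ 0) : (divConj z : ℂ) = z / starRingEnd ℂ z := by
  rw [divConj, dif_neg hz, Circle.coe_inv]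
  simp [Circle.ofConjDivSelf]

theorem divConj_mul {z w : ℂ} (hz : z ≠ 0) (hw : w ≠ 0) :
    divConj (z * w) = divConj z * divConj w := by
  ext
  rw [Circle.coe_mul, coe_divConj hz, coe_divConj hw, coe_divConj (mul_ne_zero hz hw), map_mul,
    mul_div_mul_comm]

theorem divConj_ofReal_mul {r : ℝ} (hr : r ≠ 0) (z : ℂ) : divConj (r * z) = divConj z := by
  rcases eq_or_ne z 0 with rfl | hz
  · rw [mul_zero]
  have hr' : (r : ℂ) ≠ 0 := by exact_mod_cast hr
  rw [divConj_mul hr' hz]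
  have : divConj r = 1 := by
    ext
    rw [coe_divConj hr', Complex.conj_ofReal, div_self hr', Circle.coe_one]
  rw [this, one_mul]

theorem divConj_coe_circle (u : Circle) : divConj (u : ℂ) = u ^ 2 := by
  ext
  rw [coe_divConj (Circle.coe_ne_zero u), ← Circle.coe_inv_eq_conj, Circle.coe_inv, div_inv_eq_mul,
    Circle.coe_pow, sq]

theorem Circle.exists_sq_eq (w : Circle) : ∃ u : Circle, u ^ 2 = w := by
  refine ⟨Circle.exp (Complex.arg w / 2), ?_⟩
  rw [sq, ← Circle.exp_add, add_halves, Circle.exp_arg]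

theorem continuousAt_divConj {z : ℂ} (hz : z ≠ 0) : ContinuousAt divConj z := by
  have hind : Topology.IsInducing (fun c : Circle => (c : ℂ)) := ⟨rfl⟩
  refine hind.continuousAt_iff.mpr ?_
  have h : ContinuousAt (fun w : ℂ => w / starRingEnd ℂ w) z :=
    continuousAt_id.div Complex.continuous_conj.continuousAt
      ((map_ne_zero _).mpr hz)
  refine h.congr ?_
  filter_upwards [isOpen_ne.mem_nhds hz] with w hw
  exact (coe_divConj hw).symm

theorem measurable_divConj : Measurable divConj := by
  refine measurable_of_continuousOn_compl_singleton 0 ?_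
  exact fun z hz => (continuousAt_divConj hz).continuousWithinAt

/-- The pushforward of the uniform measure on the unit disc under `z ↦ z / conj z`. -/
noncomputable def discDivConjMeasure : Measure Circle :=
  Measure.map divConj (volume.restrict (Metric.closedBall (0 : ℂ) 1))

instance isFiniteMeasure_restrict_closedBall :
    IsFiniteMeasure (volume.restrict (Metric.closedBall (0 : ℂ) 1)) :=
  isFiniteMeasure_restrict.mpr measure_closedBall_lt_top.ne

instance isFiniteMeasure_discDivConjMeasure : IsFiniteMeasure discDivConjMeasure := by
  rw [discDivConjMeasure]
  infer_instance

/-- Every element of the circle is a square u², and rotating the disc by u, which preserves area,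
multiplies z / conj z by u². -/
instance isMulLeftInvariant_discDivConjMeasure : discDivConjMeasure.IsMulLeftInvariant := by
  refine ⟨fun w => ?_⟩
  obtain ⟨u, rfl⟩ := Circle.exists_sq_eq w
  have hrot : MeasurePreserving (rotation u) (volume.restrict (Metric.closedBall (0 : ℂ) 1))
      (volume.restrict (Metric.closedBall (0 : ℂ) 1)) := by
    have h := (rotation u).measurePreserving.restrict_preimage
      (measurableSet_closedBall (x := (0 : ℂ)) (ε := 1))
    rwa [(rotation u).preimage_closedBall, map_zero] at h
  have hm : Measurable fun x : Circle => u ^ 2 * x := measurable_const_mul _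
  rw [discDivConjMeasure, Measure.map_map hm measurable_divConj]
  conv_rhs => rw [← hrot.map_eq, Measure.map_map measurable_divConj hrot.measurable]
  refine Measure.map_congr ?_
  -- The conventional value at 0 is not equivariant under rotation, but a point has area zero.
  have h0 : ∀ᵐ z : ℂ ∂volume.restrict (Metric.closedBall (0 : ℂ) 1), z ≠ 0 :=
    ae_restrict_of_ae (by simp [ae_iff])
  filter_upwards [h0] with z hz
  rw [Function.comp_apply, Function.comp_apply, rotation_apply,
    divConj_mul (Circle.coe_ne_zero u) hz, divConj_coe_circle]

/-- Uniqueness of Haar measure; the constant is nonzero because the disc has positive area. -/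
theorem exists_discDivConjMeasure_eq_smul : ∃ c : NNReal, c ≠ 0 ∧
    discDivConjMeasure = c • Measure.haarMeasure (⊤ : TopologicalSpace.PositiveCompacts Circle) := by
  refine ⟨_, fun h0 => ?_, Measure.isMulInvariant_eq_smul_of_compactSpace discDivConjMeasure
    (Measure.haarMeasure (⊤ : TopologicalSpace.PositiveCompacts Circle))⟩
  have h := Measure.isMulInvariant_eq_smul_of_compactSpace discDivConjMeasure
    (Measure.haarMeasure (⊤ : TopologicalSpace.PositiveCompacts Circle))
  rw [h0, zero_smul] at h
  have h1 : discDivConjMeasure Set.univ = 0 := by rw [h]; rfl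
  rw [discDivConjMeasure, Measure.map_apply measurable_divConj MeasurableSet.univ,
    Set.preimage_univ, Measure.restrict_apply_univ] at h1
  exact (Metric.measure_closedBall_pos volume (0 : ℂ) one_pos).ne' h1

/-- The function on the unit disc obtained by composing with `z ↦ z / conj z`, extended by zero. -/
noncomputable def discFun (f : C(Circle, ℂ)) (z : ℂ) : ℂ :=
  (Metric.closedBall (0 : ℂ) 1).indicator (fun z => f (divConj z)) z

theorem norm_discFun_le (f : C(Circle, ℂ)) (z : ℂ) : ‖discFun f z‖ ≤ ‖f‖ :=
  (norm_indicator_le_norm_self _ _).trans (f.norm_coe_le_norm _)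

theorem discFun_of_one_lt {f : C(Circle, ℂ)} {z : ℂ} (hz : 1 < ‖z‖) : discFun f z = 0 :=
  Set.indicator_of_notMem (by simpa using hz) _

theorem continuousAt_discFun (f : C(Circle, ℂ)) {z : ℂ} (hz : z ≠ 0) (hz1 : ‖z‖ ≠ 1) :
    ContinuousAt (discFun f) z := by
  rcases lt_or_gt_of_ne hz1 with h | h
  · refine (f.continuous.continuousAt.comp (continuousAt_divConj hz)).congr ?_
    filter_upwards [Metric.isOpen_ball.mem_nhds (by simpa using h : z ∈ Metric.ball (0 : ℂ) 1)]
      with w hw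
    exact (Set.indicator_of_mem (Metric.ball_subset_closedBall hw) _).symm
  · refine (continuousAt_const (y := (0 : ℂ))).congr ?_
    filter_upwards [(isOpen_lt continuous_const continuous_norm).mem_nhds h] with w hw
    exact (discFun_of_one_lt hw).symm

/-- Discontinuities can occur only at 0 and on the unit circle, a null set. -/
theorem ae_continuousAt_discFun (f : C(Circle, ℂ)) : ∀ᵐ z : ℂ, ContinuousAt (discFun f) z := by
  have h0 : ∀ᵐ z : ℂ, z ≠ 0 := by simp [ae_iff]
  have h1 : ∀ᵐ z : ℂ, z ∉ Metric.sphere (0 : ℂ) 1 :=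
    measure_eq_zero_iff_ae_notMem.mp (Measure.addHaar_sphere _ _ _)
  filter_upwards [h0, h1] with z hz hz1
  exact continuousAt_discFun f hz (by simpa using hz1)

theorem integral_discFun (f : C(Circle, ℂ)) :
    ∫ z, discFun f z = ∫ x, f x ∂discDivConjMeasure := by
  rw [discDivConjMeasure, integral_map measurable_divConj.aemeasurable
    f.continuous.measurable.aestronglyMeasurable, ← integral_indicator measurableSet_closedBall]
  rfl

theorem exists_integral_discFun_eq : ∃ c : ℂ, c ≠ 0 ∧ ∀ f : C(Circle, ℂ),
    ∫ z, discFun f z =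
      c * ∫ x, f x ∂Measure.haarMeasure (⊤ : TopologicalSpace.PositiveCompacts Circle) := by
  obtain ⟨c, hc, h⟩ := exists_discDivConjMeasure_eq_smul
  refine ⟨(c : ℝ), by exact_mod_cast hc, fun f => ?_⟩
  rw [integral_discFun, h, integral_smul_nnreal_measure, NNReal.smul_def, Complex.real_smul]

/-! ### Transfer to the plane by the basis 1, τ. -/

/-- The real linear isomorphism from the plane to `ℂ` given by the basis `1, τ`. -/
noncomputable def planeEquiv (τ : ℂ) (hτ : τ.im ≠ 0) : (ℝ × ℝ) ≃L[ℝ] ℂ :=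
  LinearEquiv.toContinuousLinearEquiv <| LinearEquiv.ofInjectiveOfFinrankEq
    ((LinearMap.fst ℝ ℝ ℝ).smulRight (1 : ℂ) + (LinearMap.snd ℝ ℝ ℝ).smulRight τ)
    (by
      rw [← LinearMap.ker_eq_bot, LinearMap.ker_eq_bot']
      rintro ⟨x, y⟩ h
      have h2 := congrArg Complex.im h
      have h1 := congrArg Complex.re h
      simp at h1 h2
      rcases h2 with rfl | h2
      · simpa using h1
      · exact absurd h2 hτ)
    (by simp)

theorem planeEquiv_apply (τ : ℂ) (hτ : τ.im ≠ 0) (x : ℝ × ℝ) :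
    planeEquiv τ hτ x = x.1 + x.2 * τ := by
  change ((LinearMap.fst ℝ ℝ ℝ).smulRight (1 : ℂ) + (LinearMap.snd ℝ ℝ ℝ).smulRight τ) x = _
  simp

theorem exists_map_planeEquiv_volume (τ : ℂ) (hτ : τ.im ≠ 0) : ∃ c : NNReal, c ≠ 0 ∧
    Measure.map (planeEquiv τ hτ) volume = c • (volume : Measure ℂ) := by
  have := (planeEquiv τ hτ).isAddHaarMeasure_map (volume : Measure (ℝ × ℝ))
  exact ⟨_, (Measure.addHaarScalarFactor_pos_of_isAddHaarMeasure _ _).ne',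
    Measure.isAddLeftInvariant_eq_smul _ _⟩

theorem exists_integral_discFun_planeEquiv_eq (τ : ℂ) (hτ : τ.im ≠ 0) :
    ∃ c : ℂ, c ≠ 0 ∧ ∀ f : C(Circle, ℂ), ∫ x, discFun f (planeEquiv τ hτ x) =
      c * ∫ x, f x ∂Measure.haarMeasure (⊤ : TopologicalSpace.PositiveCompacts Circle) := by
  obtain ⟨c, hc, h⟩ := exists_map_planeEquiv_volume τ hτ
  obtain ⟨c', hc', h'⟩ := exists_integral_discFun_eq
  refine ⟨(c : ℝ) * c', mul_ne_zero (by exact_mod_cast hc) hc', fun f => ?_⟩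
  have hmap : ∫ z, discFun f z ∂(Measure.map (planeEquiv τ hτ) volume) =
      ∫ x, discFun f (planeEquiv τ hτ x) :=
    (planeEquiv τ hτ).toHomeomorph.measurableEmbedding.integral_map (discFun f)
  rw [← hmap, h, integral_smul_nnreal_measure, h', NNReal.smul_def, Complex.real_smul, mul_assoc]

theorem ae_continuousAt_discFun_planeEquiv (τ : ℂ) (hτ : τ.im ≠ 0) (f : C(Circle, ℂ)) :
    ∀ᵐ x, ContinuousAt (fun x => discFun f (planeEquiv τ hτ x)) x := by
  obtain ⟨c, hc, h⟩ := exists_map_planeEquiv_volume τ hτ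
  have h1 : ∀ᵐ z ∂Measure.map (planeEquiv τ hτ) volume, ContinuousAt (discFun f) z := by
    rw [h]
    exact Measure.ae_smul_measure (ae_continuousAt_discFun f) c
  filter_upwards [ae_of_ae_map (planeEquiv τ hτ).continuous.measurable.aemeasurable h1] with x hx
  exact ContinuousAt.comp hx (planeEquiv τ hτ).continuous.continuousAt

theorem exists_forall_discFun_planeEquiv_eq_zero (τ : ℂ) (hτ : τ.im ≠ 0) :
    ∃ R : ℝ, ∀ (f : C(Circle, ℂ)) (x : ℝ × ℝ), R < ‖x‖ → discFun f (planeEquiv τ hτ x) = 0 := by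
  refine ⟨‖((planeEquiv τ hτ).symm : ℂ →L[ℝ] ℝ × ℝ)‖, fun f x hx => discFun_of_one_lt ?_⟩
  by_contra! h
  have h1 := ((planeEquiv τ hτ).symm : ℂ →L[ℝ] ℝ × ℝ).le_opNorm (planeEquiv τ hτ x)
  simp only [ContinuousLinearEquiv.coe_coe, ContinuousLinearEquiv.symm_apply_apply] at h1
  have := mul_le_of_le_one_right
    (norm_nonneg ((planeEquiv τ hτ).symm : ℂ →L[ℝ] ℝ × ℝ)) h
  linarith

/-! ### Periodic weights and scalings, by residue classes. -/

/-- The lattice points of the plane, sorted by their residues modulo `M`. -/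
def residueEquiv (M : ℕ) [NeZero M] : (Fin M × Fin M) × (ℤ × ℤ) ≃ ℤ × ℤ :=
  ((Equiv.prodComm _ _).trans (Equiv.prodProdProdComm ℤ ℤ (Fin M) (Fin M))).trans
    ((Int.divModEquiv M).symm.prodCongr (Int.divModEquiv M).symm)

/-- The representative with coordinates in `[0, M)` of a pair of residues modulo `M`. -/
def residueRep {M : ℕ} (ρ : Fin M × Fin M) : ℤ × ℤ := ((ρ.1 : ℕ), (ρ.2 : ℕ))

theorem residueEquiv_apply {M : ℕ} [NeZero M] (q : ℤ × ℤ) (ρ : Fin M × Fin M) :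
    residueEquiv M (ρ, q) = residueRep ρ + M • q := by
  ext <;> simp [residueEquiv, residueRep] <;> ring

/-- A function on the square lattice is periodic modulo `M`. -/
def LatticePeriodic {α : Type*} (M : ℕ) (g : ℤ × ℤ → α) : Prop :=
  ∀ z q : ℤ × ℤ, g (z + M • q) = g z

theorem LatticePeriodic.apply_residueEquiv {α : Type*} {M : ℕ} [NeZero M] {g : ℤ × ℤ → α}
    (hg : LatticePeriodic M g) (q : ℤ × ℤ) (ρ : Fin M × Fin M) :
    g (residueEquiv M (ρ, q)) = g (residueRep ρ) := by
  rw [residueEquiv_apply, hg]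

theorem LatticePeriodic.exists_pos_le {M : ℕ} [NeZero M] {φ : ℤ × ℤ → ℝ}
    (hφ : LatticePeriodic M φ) (hpos : ∀ z, 0 < φ z) : ∃ c, 0 < c ∧ ∀ z, c ≤ φ z := by
  obtain ⟨ρ, h⟩ := Finite.exists_min fun ρ : Fin M × Fin M => φ (residueRep ρ)
  refine ⟨_, hpos (residueRep ρ), fun z => ?_⟩
  obtain ⟨⟨ρ', q⟩, rfl⟩ := (residueEquiv M).surjective z
  rw [hφ.apply_residueEquiv]
  exact h ρ'

theorem latticePoint_residueEquiv {M : ℕ} [NeZero M] (q : ℤ × ℤ) (ρ : Fin M × Fin M) :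
    latticePoint (residueEquiv M (ρ, q)) =
      (M : ℝ) • (latticePoint q + (M : ℝ)⁻¹ • latticePoint (residueRep ρ)) := by
  have hM : (M : ℝ) ≠ 0 := NeZero.ne _
  rw [residueEquiv_apply, smul_add, smul_inv_smul₀ hM]
  ext <;> simp [latticePoint] <;> ring

theorem hasFiniteSupport_periodic_scaling {M : ℕ} [NeZero M] {φ : ℤ × ℤ → ℝ}
    (hφ : LatticePeriodic M φ) (hpos : ∀ z, 0 < φ z) {F : ℝ × ℝ → ℂ} {R : ℝ}
    (hF : ∀ x, R < ‖x‖ → F x = 0) {T : ℝ} (hT : 0 < T) :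
    (fun z => F (√(φ z / T) • latticePoint z)).HasFiniteSupport := by
  obtain ⟨c, hc, hcφ⟩ := hφ.exists_pos_le hpos
  have hs : 0 < √(c / T) := Real.sqrt_pos.mpr (div_pos hc hT)
  refine (finite_setOf_norm_latticePoint_le (R / √(c / T))).subset fun z hz => ?_
  have h1 : ‖√(φ z / T) • latticePoint z‖ ≤ R := not_lt.mp fun h => hz (hF _ h)
  rw [norm_smul, Real.norm_of_nonneg (Real.sqrt_nonneg _)] at h1
  rw [Set.mem_ofPred_eq, le_div_iff₀ hs, mul_comm]
  refine le_trans ?_ h1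
  gcongr
  exact hcφ z

/-- Asymptotics of a lattice sum with a periodic weight `w` and a periodic scaling `φ`. -/
theorem tendsto_inv_mul_tsum_periodic {M : ℕ} [NeZero M] {φ w : ℤ × ℤ → ℝ}
    (hφ : LatticePeriodic M φ) (hpos : ∀ z, 0 < φ z) (hw : LatticePeriodic M w)
    {F : ℝ × ℝ → ℂ} {R C : ℝ} (hF : ∀ x, R < ‖x‖ → F x = 0) (hC : ∀ x, ‖F x‖ ≤ C)
    (hcont : ∀ᵐ x, ContinuousAt F x) :
    Tendsto (fun T : ℝ => (T : ℂ)⁻¹ * ∑' z, (w z : ℂ) * F (√(φ z / T) • latticePoint z)) atTop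
      (𝓝 ((∑ ρ : Fin M × Fin M,
        w (residueRep ρ) / (φ (residueRep ρ) * (M : ℝ) ^ 2) : ℝ) * ∫ x, F x)) := by
  have hM : 0 < (M : ℝ) := by exact_mod_cast NeZero.pos M
  -- On the class ρ + Mℤ² the scaling is constant, so the scaled points form a shifted lattice of
  -- mesh M √(φ(ρ)/T).
  set ε : Fin M × Fin M → ℝ → ℝ := fun ρ T => M * √(φ (residueRep ρ) / T) with hε
  have hεpos : ∀ ρ, ∀ T > 0, 0 < ε ρ T := fun ρ T hT =>
    mul_pos hM (Real.sqrt_pos.mpr (div_pos (hpos _) hT))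
  have hεlim : ∀ ρ, Tendsto (ε ρ) atTop (𝓝[>] 0) := fun ρ => by
    refine tendsto_nhdsWithin_iff.mpr ⟨?_, ?_⟩
    · have h1 : Tendsto (fun T : ℝ => φ (residueRep ρ) / T) atTop (𝓝 0) :=
        tendsto_const_nhds.div_atTop tendsto_id
      have h2 := (Real.continuous_sqrt.tendsto 0).comp h1
      rw [Real.sqrt_zero] at h2
      simpa using h2.const_mul (M : ℝ)
    · filter_upwards [eventually_gt_atTop 0] with T hT using hεpos ρ T hT
  have key : ∀ᶠ T : ℝ in atTop,
      ∑ ρ : Fin M × Fin M, ((w (residueRep ρ) / (φ (residueRep ρ) * (M : ℝ) ^ 2) : ℝ) : ℂ) *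
        (((ε ρ T ^ 2 : ℝ) : ℂ) *
          ∑' q, F (ε ρ T • (latticePoint q + (M : ℝ)⁻¹ • latticePoint (residueRep ρ)))) =
      (T : ℂ)⁻¹ * ∑' z, (w z : ℂ) * F (√(φ z / T) • latticePoint z) := by
    filter_upwards [eventually_gt_atTop 0] with T hT
    have hsum : Summable fun z => (w z : ℂ) * F (√(φ z / T) • latticePoint z) :=
      summable_of_hasFiniteSupport <| (hasFiniteSupport_periodic_scaling hφ hpos hF hT).subset
        fun z hz => right_ne_zero_of_mul hz
    have hsum' : Summable fun c => (w (residueEquiv M c) : ℂ) *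
        F (√(φ (residueEquiv M c) / T) • latticePoint (residueEquiv M c)) :=
      (residueEquiv M).summable_iff.mpr hsum
    rw [← (residueEquiv M).tsum_eq, hsum'.tsum_prod,
      tsum_fintype, Finset.mul_sum]
    · refine Finset.sum_congr rfl fun ρ _ => ?_
      have h1 : ∀ q, (w (residueEquiv M (ρ, q)) : ℂ) *
          F (√(φ (residueEquiv M (ρ, q)) / T) • latticePoint (residueEquiv M (ρ, q))) =
          w (residueRep ρ) *
            F (ε ρ T • (latticePoint q + (M : ℝ)⁻¹ • latticePoint (residueRep ρ))) := fun q => by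
        rw [hw.apply_residueEquiv, hφ.apply_residueEquiv, latticePoint_residueEquiv, smul_smul,
          mul_comm (√_)]
      simp only [h1]
      rw [tsum_mul_left, ← mul_assoc, ← mul_assoc]
      congr 1
      have h2 : ε ρ T ^ 2 = (M : ℝ) ^ 2 * (φ (residueRep ρ) / T) := by
        rw [hε, mul_pow, Real.sq_sqrt (div_pos (hpos _) hT).le]
      rw [h2]
      have h3 : (φ (residueRep ρ) : ℂ) ≠ 0 := by exact_mod_cast (hpos _).ne'
      have h4 : (T : ℂ) ≠ 0 := by exact_mod_cast hT.ne'
      have h5 : (M : ℂ) ≠ 0 := by exact_mod_cast hM.ne'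
      push_cast
      field_simp
  refine Tendsto.congr' key ?_
  rw [Complex.ofReal_sum, Finset.sum_mul]
  refine tendsto_finsetSum _ fun ρ _ => Tendsto.const_mul _ ?_
  exact (tendsto_sq_smul_tsum_latticePoint hF hC hcont _).comp (hεlim ρ)

/-! ### Sums over lattice points with content prime to M. -/

/-- The element `a + b τ` attached to a lattice point `(a, b)`. -/
noncomputable def latticeCpx (τ : ℂ) (z : ℤ × ℤ) : ℂ := z.1 + z.2 * τ

/-- The greatest common divisor of the coordinates of a lattice point. -/
def content (z : ℤ × ℤ) : ℕ := Int.gcd z.1 z.2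

/-- The value `f (z / conj z)` at a lattice point, cut off at `‖z‖ ^ 2 * φ z ≤ T`. -/
noncomputable def latticeTerm (τ : ℂ) (φ : ℤ × ℤ → ℝ) (f : C(Circle, ℂ)) (T : ℝ) (z : ℤ × ℤ) : ℂ :=
  if ‖latticeCpx τ z‖ ^ 2 * φ z ≤ T then f (divConj (latticeCpx τ z)) else 0

theorem planeEquiv_latticePoint (τ : ℂ) (hτ : τ.im ≠ 0) (z : ℤ × ℤ) :
    planeEquiv τ hτ (latticePoint z) = latticeCpx τ z := by
  simp [planeEquiv_apply, latticePoint, latticeCpx]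

theorem latticePoint_eq_zero_iff {z : ℤ × ℤ} : latticePoint z = 0 ↔ z = 0 := by
  simp [latticePoint, Prod.ext_iff]

theorem latticeCpx_ne_zero {τ : ℂ} (hτ : τ.im ≠ 0) {z : ℤ × ℤ} (hz : z ≠ 0) :
    latticeCpx τ z ≠ 0 := by
  rwa [← planeEquiv_latticePoint τ hτ, ne_eq, EmbeddingLike.map_eq_zero_iff,
    latticePoint_eq_zero_iff]

theorem latticeCpx_nsmul (τ : ℂ) (m : ℕ) (z : ℤ × ℤ) :
    latticeCpx τ (m • z) = (m : ℝ) * latticeCpx τ z := by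
  simp [latticeCpx]
  ring

theorem content_nsmul (m : ℕ) (z : ℤ × ℤ) : content (m • z) = m * content z := by
  simp [content, Int.gcd_mul_left]

theorem content_eq_zero_iff {z : ℤ × ℤ} : content z = 0 ↔ z = 0 := by
  simp [content, Int.gcd_eq_zero_iff, Prod.ext_iff]

theorem dvd_content_iff {m : ℕ} {z : ℤ × ℤ} : m ∣ content z ↔ (m : ℤ) ∣ z.1 ∧ (m : ℤ) ∣ z.2 := by
  rw [content, ← Int.natCast_dvd_natCast, Int.dvd_coe_gcd_iff]

theorem dvd_content_iff_exists {m : ℕ} {z : ℤ × ℤ} : m ∣ content z ↔ ∃ y, m • y = z := by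
  rw [dvd_content_iff]
  constructor
  · rintro ⟨⟨a, ha⟩, b, hb⟩
    exact ⟨(a, b), by ext <;> simp [ha, hb]⟩
  · rintro ⟨y, rfl⟩
    simp

/-- A prime dividing both M and the content of z + Mq also divides the content of z. Unlike
primitivity, this condition depends only on z modulo M. -/
theorem latticePeriodic_coprime_content (M : ℕ) :
    LatticePeriodic M fun z => (content z).Coprime M := by
  have h : ∀ z q : ℤ × ℤ, (content z).Coprime M → (content (z + M • q)).Coprime M := by
    intro z q hz
    refine Nat.coprime_of_dvd fun p hp hpz hpM => ?_
    refine Nat.not_coprime_of_dvd_of_dvd hp.one_lt (dvd_content_iff.mpr ?_) hpM hz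
    have hpM' : (p : ℤ) ∣ M := Int.natCast_dvd_natCast.mpr hpM
    have h := dvd_content_iff.mp hpz
    simp at h
    exact ⟨(dvd_add_left (hpM'.mul_right _)).mp h.1, (dvd_add_left (hpM'.mul_right _)).mp h.2⟩
  intro z q
  refine propext ⟨fun h1 => ?_, h z q⟩
  have h2 := h (z + M • q) (-q) h1
  simpa using h2

open Classical in
/-- The indicator function of the lattice points whose content is coprime to `M`. -/
noncomputable def coprimeWeight (M : ℕ) (z : ℤ × ℤ) : ℝ := if (content z).Coprime M then 1 else 0

theorem latticePeriodic_coprimeWeight (M : ℕ) : LatticePeriodic M (coprimeWeight M) := by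
  intro z q
  have h := latticePeriodic_coprime_content M z q
  simp only [coprimeWeight, h]

theorem coprimeWeight_zero {M : ℕ} (hM : 1 < M) : coprimeWeight M 0 = 0 := by
  rw [coprimeWeight, if_neg]
  simp [content]
  omega

theorem coprimeWeight_nsmul (M m : ℕ) (z : ℤ × ℤ) :
    coprimeWeight M (m • z) = if m.Coprime M then coprimeWeight M z else 0 := by
  simp only [coprimeWeight, content_nsmul, Nat.coprime_mul_iff_left]
  split_ifs <;> simp_all

theorem coprimeWeight_of_content_eq_one {M : ℕ} {z : ℤ × ℤ} (hz : content z = 1) :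
    coprimeWeight M z = 1 := by
  simp [coprimeWeight, hz]

theorem coprimeWeight_nonneg (M : ℕ) (z : ℤ × ℤ) : 0 ≤ coprimeWeight M z := by
  rw [coprimeWeight]
  split_ifs <;> norm_num

theorem coprimeWeight_le_one (M : ℕ) (z : ℤ × ℤ) : coprimeWeight M z ≤ 1 := by
  rw [coprimeWeight]
  split_ifs <;> norm_num

theorem norm_latticeTerm_le (τ : ℂ) (φ : ℤ × ℤ → ℝ) (f : C(Circle, ℂ)) (T : ℝ) (z : ℤ × ℤ) :
    ‖latticeTerm τ φ f T z‖ ≤ ‖f‖ := by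
  rw [latticeTerm]
  split_ifs
  · exact f.norm_coe_le_norm _
  · simp

/-- Scaling by √(φ z / T) turns the height cutoff into the unit disc, and positive real factors do
not affect z / conj z. -/
theorem latticeTerm_eq_discFun (τ : ℂ) (hτ : τ.im ≠ 0) {φ : ℤ × ℤ → ℝ} (hpos : ∀ z, 0 < φ z)
    (f : C(Circle, ℂ)) {T : ℝ} (hT : 0 < T) (z : ℤ × ℤ) :
    latticeTerm τ φ f T z = discFun f (planeEquiv τ hτ (√(φ z / T) • latticePoint z)) := by
  have hs : 0 < √(φ z / T) := Real.sqrt_pos.mpr (div_pos (hpos z) hT)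
  classical
  rw [map_smul, planeEquiv_latticePoint, Complex.real_smul, discFun, Set.indicator_apply,
    divConj_ofReal_mul hs.ne', latticeTerm]
  have h : ‖latticeCpx τ z‖ ^ 2 * φ z ≤ T ↔
      (√(φ z / T) : ℂ) * latticeCpx τ z ∈ Metric.closedBall (0 : ℂ) 1 := by
    rw [mem_closedBall_zero_iff, norm_mul, Complex.norm_real, Real.norm_of_nonneg hs.le,
      ← sq_le_one_iff₀ (by positivity), mul_pow, Real.sq_sqrt (div_pos (hpos z) hT).le,
      div_mul_eq_mul_div, div_le_one hT, mul_comm]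
  simp only [h]

theorem exists_sq_norm_latticePoint_le (τ : ℂ) (hτ : τ.im ≠ 0) {M : ℕ} [NeZero M] {φ : ℤ × ℤ → ℝ}
    (hφ : LatticePeriodic M φ) (hpos : ∀ z, 0 < φ z) :
    ∃ c : ℝ, 0 < c ∧ ∀ (T : ℝ) (z : ℤ × ℤ), ‖latticeCpx τ z‖ ^ 2 * φ z ≤ T →
      ‖latticePoint z‖ ^ 2 ≤ c * T := by
  obtain ⟨c, hc, hcφ⟩ := hφ.exists_pos_le hpos
  set L : ℂ →L[ℝ] ℝ × ℝ := ((planeEquiv τ hτ).symm : ℂ →L[ℝ] ℝ × ℝ) with hL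
  -- The summand 1 makes the constant positive without an argument that L is nonzero.
  refine ⟨(‖L‖ + 1) ^ 2 / c, by positivity, fun T z hz => ?_⟩
  have h1 : ‖latticePoint z‖ ≤ (‖L‖ + 1) * ‖latticeCpx τ z‖ := by
    have h := L.le_opNorm (latticeCpx τ z)
    rw [← planeEquiv_latticePoint τ hτ] at h ⊢
    simp only [hL, ContinuousLinearEquiv.coe_coe, ContinuousLinearEquiv.symm_apply_apply] at h
    refine h.trans ?_
    gcongr
    simp [hL]
  calc ‖latticePoint z‖ ^ 2 ≤ ((‖L‖ + 1) * ‖latticeCpx τ z‖) ^ 2 := by gcongr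
    _ = (‖L‖ + 1) ^ 2 / c * (‖latticeCpx τ z‖ ^ 2 * c) := by field_simp
    _ ≤ (‖L‖ + 1) ^ 2 / c * (‖latticeCpx τ z‖ ^ 2 * φ z) := by gcongr; exact hcφ z
    _ ≤ _ := by gcongr

theorem finite_setOf_sq_norm_mul_le (τ : ℂ) (hτ : τ.im ≠ 0) {M : ℕ} [NeZero M] {φ : ℤ × ℤ → ℝ}
    (hφ : LatticePeriodic M φ) (hpos : ∀ z, 0 < φ z) (T : ℝ) :
    {z | ‖latticeCpx τ z‖ ^ 2 * φ z ≤ T}.Finite := by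
  obtain ⟨c, hc, h⟩ := exists_sq_norm_latticePoint_le τ hτ hφ hpos
  refine (finite_setOf_norm_latticePoint_le (√(c * T))).subset fun z hz => ?_
  exact Real.le_sqrt_of_sq_le (h T z hz)

theorem hasFiniteSupport_latticeTerm (τ : ℂ) (hτ : τ.im ≠ 0) {M : ℕ} [NeZero M] {φ : ℤ × ℤ → ℝ}
    (hφ : LatticePeriodic M φ) (hpos : ∀ z, 0 < φ z) (f : C(Circle, ℂ)) (T : ℝ) :
    (latticeTerm τ φ f T).HasFiniteSupport := by
  refine (finite_setOf_sq_norm_mul_le τ hτ hφ hpos T).subset fun z hz => ?_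
  by_contra h
  exact hz (if_neg h)

/-- The weighted sum of `f` over the lattice points with content coprime to `M`. -/
noncomputable def coprimeSum (τ : ℂ) (φ : ℤ × ℤ → ℝ) (M : ℕ) (f : C(Circle, ℂ)) (T : ℝ) : ℂ :=
  ∑' z, (coprimeWeight M z : ℂ) * latticeTerm τ φ f T z

theorem exists_tendsto_coprimeSum (τ : ℂ) (hτ : τ.im ≠ 0) {M : ℕ} (hM : 1 < M) {φ : ℤ × ℤ → ℝ}
    (hφ : LatticePeriodic M φ) (hpos : ∀ z, 0 < φ z) :
    ∃ κ : ℂ, κ ≠ 0 ∧ ∀ f : C(Circle, ℂ),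
      Tendsto (fun T : ℝ => (T : ℂ)⁻¹ * coprimeSum τ φ M f T) atTop
        (𝓝 (κ * ∫ x, f x ∂Measure.haarMeasure (⊤ : TopologicalSpace.PositiveCompacts Circle))) := by
  have : NeZero M := ⟨by omega⟩
  obtain ⟨c, hc, hcf⟩ := exists_integral_discFun_planeEquiv_eq τ hτ
  obtain ⟨R, hR⟩ := exists_forall_discFun_planeEquiv_eq_zero τ hτ
  have hM0 : 0 < (M : ℝ) := by exact_mod_cast NeZero.pos M
  refine ⟨(∑ ρ : Fin M × Fin M, coprimeWeight M (residueRep ρ) /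
    (φ (residueRep ρ) * (M : ℝ) ^ 2) : ℝ) * c, mul_ne_zero ?_ hc, fun f => ?_⟩
  · refine Complex.ofReal_ne_zero.mpr (ne_of_gt ?_)
    -- The residue class of the primitive point (1, 0) gives a positive term.
    refine Finset.sum_pos' (fun ρ _ => div_nonneg (coprimeWeight_nonneg _ _)
      (mul_pos (hpos _) (by positivity)).le) ⟨(⟨1, hM⟩, ⟨0, by omega⟩), Finset.mem_univ _, ?_⟩
    rw [coprimeWeight_of_content_eq_one (by simp [content, residueRep])]
    have := hpos (residueRep ((⟨1, hM⟩, ⟨0, by omega⟩) : Fin M × Fin M))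
    positivity
  · rw [mul_assoc, ← hcf]
    refine (tendsto_inv_mul_tsum_periodic hφ hpos (latticePeriodic_coprimeWeight M)
      (hR f) (fun x => norm_discFun_le f _)
      (ae_continuousAt_discFun_planeEquiv τ hτ f)).congr' ?_
    filter_upwards [eventually_gt_atTop 0] with T hT
    simp only [coprimeSum, latticeTerm_eq_discFun τ hτ hpos f hT]

/-- The bound must hold for every T > 0, not only for large T: it dominates the Möbius sum, where T
is replaced by T / m² for all m. -/
theorem exists_norm_coprimeSum_le (τ : ℂ) (hτ : τ.im ≠ 0) {M : ℕ} (hM : 1 < M) {φ : ℤ × ℤ → ℝ}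
    (hφ : LatticePeriodic M φ) (hpos : ∀ z, 0 < φ z) (f : C(Circle, ℂ)) :
    ∃ C : ℝ, 0 ≤ C ∧ ∀ T : ℝ, 0 < T → ‖coprimeSum τ φ M f T‖ ≤ C * T := by
  have : NeZero M := ⟨by omega⟩
  obtain ⟨c, hc, h⟩ := exists_sq_norm_latticePoint_le τ hτ hφ hpos
  refine ⟨9 * c * ‖f‖, by positivity, fun T hT => ?_⟩
  set n : ℤ := ⌊√(c * T)⌋ with hn
  have hn0 : 0 ≤ n := Int.floor_nonneg.mpr (Real.sqrt_nonneg _)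
  have hmem : ∀ z : ℤ × ℤ, (coprimeWeight M z : ℂ) * latticeTerm τ φ f T z ≠ 0 →
      z ≠ 0 ∧ ‖latticePoint z‖ ≤ √(c * T) := by
    intro z hz
    refine ⟨?_, Real.le_sqrt_of_sq_le (h T z ?_)⟩
    · rintro rfl
      simp [coprimeWeight_zero hM] at hz
    · by_contra h
      exact right_ne_zero_of_mul hz (if_neg h)
  have hbox : ∀ z : ℤ × ℤ, ‖latticePoint z‖ ≤ √(c * T) →
      z ∈ Finset.Icc (-n) n ×ˢ Finset.Icc (-n) n := by
    intro z hz
    have h : ∀ m : ℤ, ‖(m : ℝ)‖ ≤ √(c * T) → m ∈ Finset.Icc (-n) n := fun m hm => by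
      have h2 : |m| ≤ n := by
        rw [hn, Int.le_floor]
        simpa using hm
      exact Finset.mem_Icc.mpr (abs_le.mp h2)
    exact Finset.mem_product.mpr ⟨h _ ((norm_fst_le (latticePoint z)).trans hz),
      h _ ((norm_snd_le (latticePoint z)).trans hz)⟩
  rw [coprimeSum, tsum_eq_sum (s := Finset.Icc (-n) n ×ˢ Finset.Icc (-n) n)
    fun z hz => not_not.mp fun h0 => hz (hbox z (hmem z h0).2)]
  -- If n = 0 only the origin remains, and its weight is zero since M > 1. If n ≥ 1 the box has (2n
  -- + 1)² ≤ 9n² ≤ 9cT points.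
  rcases hn0.eq_or_lt with h0 | h1
  · rw [Finset.sum_eq_zero, norm_zero]
    · positivity
    · intro z hz
      by_contra hne
      refine (hmem z hne).1 ?_
      rw [← h0] at hz
      simpa [Prod.ext_iff] using hz
  · refine (norm_sum_le_of_le (n := fun _ => ‖f‖) _ fun z _ => ?_).trans ?_
    · rw [norm_mul, Complex.norm_real, Real.norm_of_nonneg (coprimeWeight_nonneg _ _)]
      exact (mul_le_of_le_one_left (norm_nonneg _) (coprimeWeight_le_one _ _)).trans
        (norm_latticeTerm_le _ _ _ _ _)
    · rw [Finset.sum_const, Finset.card_product, Int.card_Icc, nsmul_eq_mul]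
      have h2 : ((n + 1 - -n).toNat : ℝ) = 2 * n + 1 := by
        have h3 : (((n + 1 - -n).toNat : ℤ) : ℝ) = ((n + 1 - -n : ℤ) : ℝ) := by
          rw [Int.toNat_of_nonneg (by omega)]
        push_cast at h3
        linarith
      push_cast
      rw [h2]
      have h4 : (1 : ℝ) ≤ n := by exact_mod_cast h1
      have h5 : (n : ℝ) ^ 2 ≤ c * T := by
        rw [← Real.sq_sqrt (mul_pos hc hT).le]
        have := Int.floor_le √(c * T)
        gcongr
      have h6 : (2 * (n : ℝ) + 1) * (2 * n + 1) ≤ 9 * (c * T) := by nlinarith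
      calc _ ≤ 9 * (c * T) * ‖f‖ := by gcongr
        _ = _ := by ring

/-! ### Möbius inversion to primitive lattice points. -/

open Classical in
/-- The Möbius function of `m` if `m` is coprime to `M`, and zero otherwise. -/
noncomputable def coprimeMoebius (M m : ℕ) : ℂ :=
  if m.Coprime M then (ArithmeticFunction.moebius m : ℂ) else 0

theorem norm_coprimeMoebius_le (M m : ℕ) : ‖coprimeMoebius M m‖ ≤ 1 := by
  rw [coprimeMoebius]
  split_ifs
  · rw [Complex.norm_intCast]
    exact_mod_cast ArithmeticFunction.abs_moebius_le_one
  · simp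

/-- The sum is the Dirichlet series at 2 of μ times the principal character modulo M, which is the
inverse of the L-series of that character. -/
theorem tsum_coprimeMoebius_div_sq_ne_zero (M : ℕ) :
    ∑' m : ℕ, coprimeMoebius M m / (m : ℂ) ^ 2 ≠ 0 := by
  have h := DirichletCharacter.LSeries.mul_mu_eq_one (1 : DirichletCharacter ℂ M) (s := 2)
    (by norm_num)
  have h2 := right_ne_zero_of_mul (h.trans_ne one_ne_zero)
  convert h2 using 1
  rw [LSeries]
  refine tsum_congr fun m => ?_
  rw [LSeries.term_def]
  rcases eq_or_ne m 0 with rfl | hm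
  · simp [coprimeMoebius]
  · rw [if_neg hm, Pi.mul_apply, coprimeMoebius]
    split_ifs with h
    · rw [MulChar.one_apply ((ZMod.isUnit_iff_coprime m M).mpr h), one_mul]
      norm_num
    · rw [MulChar.map_nonunit _ (mt (ZMod.isUnit_iff_coprime m M).mp h), zero_mul, zero_div, zero_div]

theorem sum_divisors_moebius (n : ℕ) :
    ∑ m ∈ n.divisors, (ArithmeticFunction.moebius m : ℂ) = if n = 1 then 1 else 0 := by
  have h : (ArithmeticFunction.moebius * ArithmeticFunction.zeta : ArithmeticFunction ℤ) n =
      (1 : ArithmeticFunction ℤ) n := by rw [ArithmeticFunction.moebius_mul_coe_zeta]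
  rw [ArithmeticFunction.coe_mul_zeta_apply, ArithmeticFunction.one_apply] at h
  exact_mod_cast congrArg (Int.cast : ℤ → ℂ) h

open Classical in
/-- The sum of `f (z / conj z)` over the primitive lattice points with `‖z‖ ^ 2 * φ z ≤ T`. -/
noncomputable def primitiveSum (τ : ℂ) (φ : ℤ × ℤ → ℝ) (f : C(Circle, ℂ)) (T : ℝ) : ℂ :=
  ∑' z, if content z = 1 then latticeTerm τ φ f T z else 0

theorem latticeTerm_nsmul (τ : ℂ) {φ : ℤ × ℤ → ℝ} (f : C(Circle, ℂ)) (T : ℝ) {m : ℕ} (hm : m ≠ 0)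
    {z : ℤ × ℤ} (hz : φ (m • z) = φ z) :
    latticeTerm τ φ f T (m • z) = latticeTerm τ φ f (T / (m : ℝ) ^ 2) z := by
  have hm0 : (0 : ℝ) < m := by exact_mod_cast hm.bot_lt
  have h : ‖((m : ℝ) : ℂ) * latticeCpx τ z‖ ^ 2 * φ z ≤ T ↔
      ‖latticeCpx τ z‖ ^ 2 * φ z ≤ T / (m : ℝ) ^ 2 := by
    rw [norm_mul, Complex.norm_real, Real.norm_of_nonneg hm0.le, le_div_iff₀ (by positivity),
      mul_pow]
    ring_nf
  rw [latticeTerm, latticeTerm, latticeCpx_nsmul, hz, divConj_ofReal_mul hm0.ne']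
  simp only [h]

/-- Möbius inversion from all lattice points with content coprime to `M` to primitive ones. -/
theorem primitiveSum_eq_tsum (τ : ℂ) (hτ : τ.im ≠ 0) {M : ℕ} (hM : 1 < M) {φ : ℤ × ℤ → ℝ}
    (hφ : LatticePeriodic M φ) (hpos : ∀ z, 0 < φ z)
    (hmul : ∀ (m : ℕ) z, m.Coprime M → φ (m • z) = φ z) (f : C(Circle, ℂ)) (T : ℝ) :
    primitiveSum τ φ f T =
      ∑' m : ℕ, coprimeMoebius M m * coprimeSum τ φ M f (T / (m : ℝ) ^ 2) := by
  classical
  have : NeZero M := ⟨by omega⟩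
  set g : ℤ × ℤ → ℂ := fun z => (coprimeWeight M z : ℂ) * latticeTerm τ φ f T z with hg
  have hg0 : g 0 = 0 := by simp [hg, coprimeWeight_zero hM]
  have hgfin : {z | g z ≠ 0}.Finite :=
    (hasFiniteSupport_latticeTerm τ hτ hφ hpos f T).subset fun z hz => right_ne_zero_of_mul hz
  -- Summing over m first detects content 1 by Σ μ(m) over divisors; summing over z first and
  -- substituting z = m y gives the scaled sums. Finite support allows the exchange.
  set P : ℕ → ℤ × ℤ → ℂ := fun m z =>
    if m ∣ content z then (ArithmeticFunction.moebius m : ℂ) * g z else 0 with hP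
  have hPsum : Summable (Function.uncurry P) := by
    refine summable_of_hasFiniteSupport ?_
    refine (hgfin.biUnion fun z _ =>
      ((content z).divisors.finite_toSet.prod (Set.finite_singleton z))).subset ?_
    rintro ⟨m, z⟩ hmz
    simp only [Function.mem_support, Function.uncurry_apply_pair, hP, ne_eq, ite_eq_right_iff,
      Classical.not_imp] at hmz
    have hgz : g z ≠ 0 := right_ne_zero_of_mul hmz.2
    refine Set.mem_biUnion hgz ⟨?_, rfl⟩
    refine Nat.mem_divisors.mpr ⟨hmz.1, fun h0 => hgz ?_⟩
    rw [content_eq_zero_iff.mp h0, hg0]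
  have h1 : ∀ z, ∑' m, P m z = if content z = 1 then latticeTerm τ φ f T z else 0 := by
    intro z
    by_cases hz : z = 0
    · subst hz
      simp [hP, hg0, content]
    have hc : content z ≠ 0 := fun h => hz (content_eq_zero_iff.mp h)
    rw [tsum_eq_sum (s := (content z).divisors) fun m hm => if_neg fun h =>
      hm (Nat.mem_divisors.mpr ⟨h, hc⟩)]
    rw [Finset.sum_congr rfl fun m hm => if_pos (Nat.dvd_of_mem_divisors hm), ← Finset.sum_mul,
      sum_divisors_moebius]
    split_ifs with h
    · simp [hg, coprimeWeight_of_content_eq_one h]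
    · simp
  have h2 : ∀ m, ∑' z, P m z = coprimeMoebius M m * coprimeSum τ φ M f (T / (m : ℝ) ^ 2) := by
    intro m
    rcases eq_or_ne m 0 with rfl | hm
    · simp [hP, coprimeMoebius]
    have hinj : Function.Injective fun y : ℤ × ℤ => m • y := smul_right_injective _ hm
    rw [← hinj.tsum_eq (f := P m)]
    · have h3 : ∀ y, P m (m • y) = coprimeMoebius M m *
          ((coprimeWeight M y : ℂ) * latticeTerm τ φ f (T / (m : ℝ) ^ 2) y) := by
        intro y
        simp only [hP, hg, content_nsmul, dvd_mul_right, if_true, coprimeWeight_nsmul,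
          coprimeMoebius]
        split_ifs with h
        · rw [latticeTerm_nsmul τ f T hm (hmul m y h)]
        · simp
      simp only [h3]
      rw [tsum_mul_left, coprimeSum]
    · intro z hz
      have h4 : m ∣ content z := by
        by_contra h
        exact hz (if_neg h)
      exact dvd_content_iff_exists.mp h4
  rw [primitiveSum, ← tsum_congr h1, ← tsum_congr h2, hPsum.tsum_comm]

/-- Dominated convergence over m with majorant C / m²; the term for m tends to μ(m) / m² times the
limit for the coprime sum when m is prime to M, and vanishes otherwise. -/
theorem exists_tendsto_primitiveSum (τ : ℂ) (hτ : τ.im ≠ 0) {M : ℕ} (hM : 1 < M) {φ : ℤ × ℤ → ℝ}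
    (hφ : LatticePeriodic M φ) (hpos : ∀ z, 0 < φ z)
    (hmul : ∀ (m : ℕ) z, m.Coprime M → φ (m • z) = φ z) :
    ∃ κ : ℂ, κ ≠ 0 ∧ ∀ f : C(Circle, ℂ),
      Tendsto (fun T : ℝ => (T : ℂ)⁻¹ * primitiveSum τ φ f T) atTop
        (𝓝 (κ * ∫ x, f x ∂Measure.haarMeasure (⊤ : TopologicalSpace.PositiveCompacts Circle))) := by
  obtain ⟨κ, hκ, hlim⟩ := exists_tendsto_coprimeSum τ hτ hM hφ hpos
  refine ⟨(∑' m : ℕ, coprimeMoebius M m / (m : ℂ) ^ 2) * κ,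
    mul_ne_zero (tsum_coprimeMoebius_div_sq_ne_zero M) hκ, fun f => ?_⟩
  obtain ⟨C, hC0, hC⟩ := exists_norm_coprimeSum_le τ hτ hM hφ hpos f
  set I := κ * ∫ x, f x ∂Measure.haarMeasure (⊤ : TopologicalSpace.PositiveCompacts Circle)
  have hsq : Summable fun m : ℕ => C * ((m : ℝ) ^ 2)⁻¹ :=
    (Real.summable_nat_pow_inv.mpr one_lt_two).mul_left C
  have h := tendsto_tsum_of_dominated_convergence (𝓕 := atTop)
    (f := fun (T : ℝ) (m : ℕ) =>
      (T : ℂ)⁻¹ * (coprimeMoebius M m * coprimeSum τ φ M f (T / (m : ℝ) ^ 2)))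
    (g := fun m => coprimeMoebius M m / (m : ℂ) ^ 2 * I) hsq ?_ ?_
  · rw [tsum_mul_right] at h
    rw [mul_assoc]
    refine h.congr fun T => ?_
    rw [tsum_mul_left, primitiveSum_eq_tsum τ hτ hM hφ hpos hmul]
  · intro m
    -- The index 0, where T / m² takes the default value 0, drops out because μ(0) = 0.
    rcases eq_or_ne m 0 with rfl | hm
    · simp [coprimeMoebius]
    have hm0 : (0 : ℝ) < (m : ℝ) ^ 2 := by positivity
    refine (((hlim f).comp (tendsto_id.atTop_div_const hm0)).const_mul
      (coprimeMoebius M m / (m : ℂ) ^ 2)).congr' ?_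
    filter_upwards [eventually_gt_atTop 0] with T hT
    have h1 : (T : ℂ) ≠ 0 := by exact_mod_cast hT.ne'
    have h2 : (m : ℂ) ≠ 0 := by exact_mod_cast hm
    simp only [Function.comp_apply, id_eq]
    push_cast
    field_simp
  · filter_upwards [eventually_gt_atTop 0] with T hT m
    rcases eq_or_ne m 0 with rfl | hm
    · simp [coprimeMoebius]
    have hm0 : (0 : ℝ) < (m : ℝ) ^ 2 := by positivity
    rw [norm_mul, norm_mul, norm_inv, Complex.norm_real, Real.norm_of_nonneg hT.le]
    calc T⁻¹ * (‖coprimeMoebius M m‖ * ‖coprimeSum τ φ M f (T / (m : ℝ) ^ 2)‖)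
        ≤ T⁻¹ * (1 * (C * (T / (m : ℝ) ^ 2))) := by
          gcongr
          · exact norm_coprimeMoebius_le M m
          · exact hC _ (div_pos hT hm0)
      _ = C * ((m : ℝ) ^ 2)⁻¹ := by field_simp

/-! ### Generator and conjugation of an imaginary quadratic field. -/

/-- An imaginary quadratic field is generated by a square root `θ` of a negative integer; its
nontrivial automorphism `s` maps `θ` to `-θ`. -/
theorem exists_sqrt_neg_generator (K : Type*) [Field K] [NumberField K]
    [Algebra.IsQuadraticExtension ℚ K] [IsTotallyComplex K] :
    ∃ (s : K ≃ₐ[ℚ] K) (θ : K) (d : ℕ), 0 < d ∧ θ ^ 2 = -(d : K) ∧ s θ = -θ ∧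
      (∀ x : K, ∃ a b : ℚ, x = a + b * θ) ∧
      ∀ x : K, algebraMap ℚ K (Algebra.norm ℚ x) = x * s x := by
  classical
  have hcard : Fintype.card (K ≃ₐ[ℚ] K) = 2 := by
    rw [← Nat.card_eq_fintype_card, IsGalois.card_aut_eq_finrank,
      Algebra.IsQuadraticExtension.finrank_eq_two]
  obtain ⟨s, hs⟩ : ∃ s : K ≃ₐ[ℚ] K, s ≠ 1 := by
    have : Nontrivial (K ≃ₐ[ℚ] K) := Fintype.one_lt_card_iff_nontrivial.mp (by omega)
    exact exists_ne 1
  have huniv : (Finset.univ : Finset (K ≃ₐ[ℚ] K)) = {1, s} := by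
    refine (Finset.eq_of_subset_of_card_le (Finset.subset_univ _) ?_).symm
    rw [Finset.card_pair hs.symm, Finset.card_univ, hcard]
  have hall : ∀ g : K ≃ₐ[ℚ] K, g = 1 ∨ g = s := fun g => by
    have := Finset.mem_univ g
    rw [huniv] at this
    simpa using this
  have hss : ∀ x, s (s x) = x := fun x => by
    have h : s * s = 1 := by
      rcases hall (s * s) with h | h
      · exact h
      · exact absurd (mul_eq_left.mp h) hs
    exact congrArg (fun g : K ≃ₐ[ℚ] K => g x) h
  have hfix : ∀ x, s x = x → ∃ q : ℚ, (q : K) = x := fun x hx => by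
    have h : x ∈ (⊥ : IntermediateField ℚ K) := (IsGalois.mem_bot_iff_fixed x).mpr fun g => by
      rcases hall g with rfl | rfl
      · rfl
      · exact hx
    obtain ⟨q, hq⟩ := IntermediateField.mem_bot.mp h
    exact ⟨q, by simpa using hq⟩
  obtain ⟨x, hx⟩ : ∃ x, s x ≠ x := by
    by_contra! h
    exact hs (AlgEquiv.ext h)
  -- This y is anti-invariant under s, so y² is a rational number r and 1, y span K.
  set y := x - s x with hy
  have hsy : s y = -y := by rw [hy, map_sub, hss]; ring
  have hy0 : y ≠ 0 := sub_ne_zero.mpr hx.symm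
  obtain ⟨r, hr⟩ := hfix (y ^ 2) (by rw [map_pow, hsy, neg_sq])
  have hgen : ∀ w : K, ∃ a b : ℚ, w = a + b * y := fun w => by
    obtain ⟨a, ha⟩ := hfix ((w + s w) / 2) (by
      rw [map_div₀, map_add, hss, map_ofNat, add_comm])
    obtain ⟨b, hb⟩ := hfix ((w - s w) / (2 * y)) (by
      rw [map_div₀, map_mul, map_sub, hss, map_ofNat, hsy, mul_neg, div_neg, ← neg_div, neg_sub])
    refine ⟨a, b, ?_⟩
    rw [ha, hb]
    field_simp
    ring
  -- If r ≥ 0, then y has a real image, so the embedding is real, against total complexity.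
  have hr0 : r < 0 := by
    by_contra! hr0
    let σ : K →+* ℂ := Classical.arbitrary _
    have h1 : (σ y) ^ 2 = ((√(r : ℝ) : ℝ) : ℂ) ^ 2 := by
      rw [← map_pow, ← hr, map_ratCast, ← Complex.ofReal_pow,
        Real.sq_sqrt (by exact_mod_cast hr0), Complex.ofReal_ratCast]
    have h2 : starRingEnd ℂ (σ y) = σ y := by
      rcases sq_eq_sq_iff_eq_or_eq_neg.mp h1 with h | h <;> rw [h] <;> simp
    have h3 : ComplexEmbedding.IsReal σ := by
      refine RingHom.ext fun w => ?_
      obtain ⟨a, b, rfl⟩ := hgen w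
      simp [ComplexEmbedding.conjugate_coe_eq, h2]
    exact InfinitePlace.not_isReal_iff_isComplex.mpr (IsTotallyComplex.isComplex _)
      (InfinitePlace.isReal_mk_iff.mpr h3)
  have hden : (r.den : K) ≠ 0 := by exact_mod_cast r.den_ne_zero
  have hnum : r.num < 0 := Rat.num_neg.mpr hr0
  -- Multiplying y by the denominator of r makes its square the integer r.num * r.den.
  refine ⟨s, r.den * y, r.num.natAbs * r.den,
    Nat.mul_pos (Int.natAbs_pos.mpr hnum.ne) r.den_pos, ?_, ?_, ?_, ?_⟩
  · have h1 : (r : K) * r.den = r.num := by exact_mod_cast Rat.mul_den_eq_num r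
    have h2 : ((r.num.natAbs : ℕ) : K) = -(r.num : K) := by
      have h3 : ((r.num.natAbs : ℕ) : ℤ) = -r.num := by omega
      rw [← Int.cast_natCast, h3, Int.cast_neg]
    rw [mul_pow, ← hr, Nat.cast_mul, h2, ← h1]
    ring
  · rw [map_mul, map_natCast, hsy, mul_neg]
  · intro w
    obtain ⟨a, b, rfl⟩ := hgen w
    refine ⟨a, b / r.den, ?_⟩
    push_cast
    field_simp
  · intro w
    rw [Algebra.norm_eq_prod_automorphisms, huniv, Finset.prod_pair hs.symm]
    rfl

/-! ### Local factors of the height. -/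

section

variable {K : Type*} [Field K]

/-- The element `a + b θ` of `K` attached to a lattice point `(a, b)`. -/
def latticeElt (θ : K) (z : ℤ × ℤ) : K := z.1 + z.2 * θ

theorem latticeElt_add (θ : K) (z q : ℤ × ℤ) :
    latticeElt θ (z + q) = latticeElt θ z + latticeElt θ q := by
  simp [latticeElt]
  ring

theorem latticeElt_nsmul (θ : K) (m : ℕ) (z : ℤ × ℤ) :
    latticeElt θ (m • z) = m * latticeElt θ z := by
  simp [latticeElt]
  ring

theorem map_latticeElt {L : Type*} [Field L] (g : K →+* L) (θ : K) (z : ℤ × ℤ) :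
    g (latticeElt θ z) = latticeElt (g θ) z := by
  simp [latticeElt]

variable [NumberField K]

theorem NumberField.FinitePlace.apply_intCast_le_one (v : FinitePlace K) (n : ℤ) : v (n : K) ≤ 1 := by
  rw [← FinitePlace.norm_embedding_eq, FinitePlace.norm_embedding]
  exact HeightOneSpectrum.adicAbv_intCast_le_one K _ n

theorem NumberField.FinitePlace.apply_natCast_le_one (v : FinitePlace K) (n : ℕ) : v (n : K) ≤ 1 := by
  exact_mod_cast FinitePlace.apply_intCast_le_one v n

theorem NumberField.FinitePlace.sub_le (v : FinitePlace K) (x y : K) : v (x - y) ≤ max (v x) (v y) := by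
  rw [sub_eq_add_neg, ← map_neg_eq_map v y]
  exact FinitePlace.add_le v x (-y)

theorem NumberField.FinitePlace.mul_le_of_le_one_left (v : FinitePlace K) {x : K} (hx : v x ≤ 1) (y : K) :
    v (x * y) ≤ v y := by
  rw [map_mul]
  exact _root_.mul_le_of_le_one_left (apply_nonneg v y) hx

theorem NumberField.FinitePlace.apply_le_one_of_sq_eq_neg {θ : K} {d : ℕ} (hθ : θ ^ 2 = -(d : K))
    (v : FinitePlace K) : v θ ≤ 1 := by
  rw [← sq_le_one_iff₀ (apply_nonneg v θ), ← map_pow, hθ, map_neg_eq_map]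
  exact FinitePlace.apply_natCast_le_one v d

theorem NumberField.FinitePlace.apply_latticeElt_le_one {θ : K} (v : FinitePlace K) (hθ : v θ ≤ 1)
    (z : ℤ × ℤ) : v (latticeElt θ z) ≤ 1 := by
  refine (FinitePlace.add_le v _ _).trans (max_le (FinitePlace.apply_intCast_le_one v _) ?_)
  exact (FinitePlace.mul_le_of_le_one_left v (FinitePlace.apply_intCast_le_one v _) θ).trans hθ

/-- The local factor at `v` of the finite part of the height of `[a + b θ : a - b θ]`, truncated
below at `v M`. -/
noncomputable def localFactor (θ : K) (M : ℕ) (v : FinitePlace K) (z : ℤ × ℤ) : ℝ :=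
  max (max (v (latticeElt θ z)) (v (latticeElt (-θ) z))) (v (M : K))

/-- The finite part of the height of `[a + b θ : a - b θ]`, truncated at the places above `M`. -/
noncomputable def finiteFactor (θ : K) (M : ℕ) (z : ℤ × ℤ) : ℝ :=
  ∏ᶠ v : FinitePlace K, localFactor θ M v z

theorem finiteFactor_pos (θ : K) {M : ℕ} (hM : M ≠ 0) (z : ℤ × ℤ) : 0 < finiteFactor θ M z := by
  refine finprod_induction (0 < ·) one_pos (fun _ _ => mul_pos) fun v => ?_
  exact lt_max_of_lt_right (FinitePlace.pos_iff.mpr (by exact_mod_cast hM))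

/-- By the ultrametric inequality a translation by Mq changes each coordinate by at most |M|_v,
which the truncation absorbs. The reverse inequality is translation by -Mq. -/
theorem latticePeriodic_localFactor {θ : K} (M : ℕ) {v : FinitePlace K} (hθ : v θ ≤ 1) :
    LatticePeriodic M (localFactor θ M v) := by
  have h1 : ∀ {η : K}, v η ≤ 1 → ∀ z q : ℤ × ℤ,
      v (latticeElt η (z + M • q)) ≤ max (v (latticeElt η z)) (v (M : K)) := by
    intro η hη z q
    rw [latticeElt_add, latticeElt_nsmul, mul_comm]
    exact (FinitePlace.add_le v _ _).trans (max_le_max le_rfl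
      (FinitePlace.mul_le_of_le_one_left v (FinitePlace.apply_latticeElt_le_one v hη q) _))
  have hθ' : v (-θ) ≤ 1 := by rwa [map_neg_eq_map]
  have h2 : ∀ z q : ℤ × ℤ, localFactor θ M v (z + M • q) ≤ localFactor θ M v z := by
    intro z q
    refine max_le (max_le ?_ ?_) (le_max_right _ _)
    · exact (h1 hθ z q).trans (max_le_max (le_max_left _ _) le_rfl)
    · exact (h1 hθ' z q).trans (max_le_max (le_max_right _ _) le_rfl)
  intro z q
  refine le_antisymm (h2 z q) ?_
  simpa using h2 (z + M • q) (-q)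

/-- If |m|_v = 1 nothing changes. If |m|_v < 1, Bézout forces |M|_v = 1, and the truncated factor is
identically 1. -/
theorem localFactor_nsmul {θ : K} {M m : ℕ} (hm : m.Coprime M) {v : FinitePlace K}
    (hθ : v θ ≤ 1) (z : ℤ × ℤ) : localFactor θ M v (m • z) = localFactor θ M v z := by
  have hθ' : v (-θ) ≤ 1 := by rwa [map_neg_eq_map]
  have hMle := FinitePlace.apply_natCast_le_one v M
  rcases (FinitePlace.apply_natCast_le_one v m).lt_or_eq with h | h
  · have hM1 : v (M : K) = 1 := by
      refine le_antisymm hMle (not_lt.mp fun hlt => ?_)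
      have hc : IsCoprime (m : ℤ) M := Nat.isCoprime_iff_coprime.mpr hm
      obtain ⟨a, b, hab⟩ := hc
      have hab' : (a : K) * m + b * M = 1 := by exact_mod_cast congrArg (Int.cast : ℤ → K) hab
      have h1 := FinitePlace.add_le v ((a : K) * m) (b * M)
      rw [hab', map_one] at h1
      refine absurd (h1.trans (max_le_max
        (FinitePlace.mul_le_of_le_one_left v (FinitePlace.apply_intCast_le_one v a) _)
        (FinitePlace.mul_le_of_le_one_left v (FinitePlace.apply_intCast_le_one v b) _))) ?_
      exact not_le.mpr (max_lt h hlt)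
    have h2 : ∀ y, localFactor θ M v y = 1 := fun y => by
      rw [localFactor, hM1]
      exact max_eq_right (max_le (FinitePlace.apply_latticeElt_le_one v hθ y)
        (FinitePlace.apply_latticeElt_le_one v hθ' y))
    rw [h2, h2]
  · simp only [localFactor, latticeElt_nsmul, map_mul, h, one_mul]

theorem le_max_apply_latticeElt {θ : K} {d : ℕ} (hθ : θ ^ 2 = -(d : K)) (v : FinitePlace K)
    {z : ℤ × ℤ} (hz : content z = 1) :
    v ((2 * d : ℕ) : K) ≤ max (v (latticeElt θ z)) (v (latticeElt (-θ) z)) := by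
  obtain ⟨a, b, hab⟩ := Int.isCoprime_iff_gcd_eq_one.mpr hz
  have hab' : (a : K) * z.1 + b * z.2 = 1 := by exact_mod_cast congrArg (Int.cast : ℤ → K) hab
  -- With a z₁ + b z₂ = 1, the sum of the two conjugates is 2z₁ and their difference is 2z₂θ, so 2d
  -- is an integral combination of them.
  have h : ((2 * d : ℕ) : K) =
      ((a * d : ℤ) : K) * (latticeElt θ z + latticeElt (-θ) z) -
        ((b : K) * θ) * (latticeElt θ z - latticeElt (-θ) z) := by
    simp only [latticeElt]
    push_cast
    linear_combination (-2 * (d : K)) * hab' + 2 * b * z.2 * hθ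
  rw [h]
  refine (FinitePlace.sub_le v _ _).trans (max_le ?_ ?_)
  · exact (FinitePlace.mul_le_of_le_one_left v (FinitePlace.apply_intCast_le_one v _) _).trans
      (FinitePlace.add_le v _ _)
  · refine (FinitePlace.mul_le_of_le_one_left v ?_ _).trans (FinitePlace.sub_le v _ _)
    exact (FinitePlace.mul_le_of_le_one_left v (FinitePlace.apply_intCast_le_one v _) _).trans
      (FinitePlace.apply_le_one_of_sq_eq_neg hθ v)

end

/-! ### Elements of norm one as pairs of primitive lattice points. -/

theorem iSup_fin_two (a b : ℝ) : ⨆ i, ![a, b] i = max a b :=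
  eq_of_forall_ge_iff fun c => by
    rw [ciSup_le_iff (Set.finite_range _).bddAbove, Fin.forall_fin_two, max_le_iff]
    rfl

theorem conj_eq_neg_of_sq_eq_neg {τ : ℂ} {d : ℕ} (hd : 0 < d) (hτ : τ ^ 2 = -(d : ℂ)) :
    τ.im ≠ 0 ∧ starRingEnd ℂ τ = -τ := by
  have h1 := congrArg Complex.re hτ
  have h2 := congrArg Complex.im hτ
  simp only [sq, Complex.mul_re, Complex.mul_im, Complex.neg_re, Complex.neg_im,
    Complex.natCast_re, Complex.natCast_im, neg_zero] at h1 h2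
  have hd' : (0 : ℝ) < d := by exact_mod_cast hd
  have him : τ.im ≠ 0 := fun h => by
    rw [h] at h1
    nlinarith [mul_self_nonneg τ.re]
  refine ⟨him, ?_⟩
  have hre : τ.re = 0 := by
    have h3 : τ.re * τ.im = 0 := by linarith
    exact (mul_eq_zero.mp h3).resolve_right him
  exact Complex.ext (by simp [hre]) (by simp)

theorem conj_latticeCpx {τ : ℂ} (hτ : starRingEnd ℂ τ = -τ) (z : ℤ × ℤ) :
    starRingEnd ℂ (latticeCpx τ z) = latticeCpx (-τ) z := by
  simp [latticeCpx, hτ]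

/-- Equal values of z / conj z make the two integer vectors proportional, and proportional primitive
vectors agree up to sign. -/
theorem eq_or_eq_neg_of_divConj_eq {τ : ℂ} (him : τ.im ≠ 0) (hτ : starRingEnd ℂ τ = -τ)
    {z w : ℤ × ℤ} (hz : content z = 1) (hw : content w = 1)
    (h : divConj (latticeCpx τ z) = divConj (latticeCpx τ w)) : w = z ∨ w = -z := by
  have hz0 : z ≠ 0 := fun h => by simp [h, content] at hz
  have hw0 : w ≠ 0 := fun h => by simp [h, content] at hw
  have h1 := congrArg (fun c : Circle => (c : ℂ)) h
  have hcz := (map_ne_zero (starRingEnd ℂ)).mpr (latticeCpx_ne_zero him hz0)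
  have hcw := (map_ne_zero (starRingEnd ℂ)).mpr (latticeCpx_ne_zero him hw0)
  simp only [coe_divConj (latticeCpx_ne_zero him hz0),
    coe_divConj (latticeCpx_ne_zero him hw0)] at h1
  rw [div_eq_div_iff hcz hcw, conj_latticeCpx hτ, conj_latticeCpx hτ] at h1
  have hτ0 : τ ≠ 0 := fun h => by simp [h] at him
  have h2 : ((z.2 * w.1 : ℤ) : ℂ) = ((z.1 * w.2 : ℤ) : ℂ) := by
    refine mul_left_cancel₀ (mul_ne_zero two_ne_zero hτ0) ?_
    simp only [latticeCpx] at h1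
    push_cast
    linear_combination h1
  have h3 : z.2 * w.1 = z.1 * w.2 := by exact_mod_cast h2
  have hzc : IsCoprime z.1 z.2 := Int.isCoprime_iff_gcd_eq_one.mpr hz
  have hwc : IsCoprime w.1 w.2 := Int.isCoprime_iff_gcd_eq_one.mpr hw
  obtain ⟨a, b, hab⟩ := hzc
  obtain ⟨a', b', hab'⟩ := hwc
  -- The Bézout coefficients of z recover the factor n in w = n z; primitivity of w makes n a unit.
  set n : ℤ := a * w.1 + b * w.2 with hn
  have e1 : w.1 = n * z.1 := by linear_combination (-w.1) * hab + b * h3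
  have e2 : w.2 = n * z.2 := by linear_combination (-w.2) * hab - a * h3
  have hu : IsUnit n := IsUnit.of_mul_eq_one (a' * z.1 + b' * z.2) (by
    rw [e1, e2] at hab'
    linear_combination hab')
  rcases Int.isUnit_iff.mp hu with h | h
  · left
    ext
    · rw [e1, h, one_mul]
    · rw [e2, h, one_mul]
  · right
    ext
    · rw [e1, h]; simp
    · rw [e2, h]; simp

theorem content_neg (z : ℤ × ℤ) : content (-z) = content z := by
  simp [content]

theorem latticeCpx_neg (τ : ℂ) (z : ℤ × ℤ) : latticeCpx τ (-z) = ((-1 : ℝ) : ℂ) * latticeCpx τ z := by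
  simp [latticeCpx]
  ring

theorem finiteFactor_neg {K : Type*} [Field K] [NumberField K] (θ : K) (M : ℕ) (z : ℤ × ℤ) :
    finiteFactor θ M (-z) = finiteFactor θ M z := by
  have h : ∀ η : K, latticeElt η (-z) = -latticeElt η z := fun η => by
    simp [latticeElt]
    ring
  simp only [finiteFactor, localFactor, h, map_neg_eq_map]

/-- The primitive lattice points with `‖z‖ ^ 2 * φ z ≤ T`. -/
def primitiveSet (τ : ℂ) (φ : ℤ × ℤ → ℝ) (T : ℝ) : Set (ℤ × ℤ) :=
  {z | content z = 1 ∧ ‖latticeCpx τ z‖ ^ 2 * φ z ≤ T}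

/-- Each fibre of z ↦ z / conj z over the image is a pair {z, -z}, whence the factor 2. -/
theorem primitiveSum_eq_two_mul_finsum {τ : ℂ} (him : τ.im ≠ 0) (hτ : starRingEnd ℂ τ = -τ)
    {φ : ℤ × ℤ → ℝ} (hφ : ∀ z, φ (-z) = φ z) (f : C(Circle, ℂ)) {T : ℝ}
    (hfin : (primitiveSet τ φ T).Finite) :
    primitiveSum τ φ f T =
      2 * ∑ᶠ b ∈ (fun z => divConj (latticeCpx τ z)) '' primitiveSet τ φ T, f b := by
  classical
  set g : ℤ × ℤ → Circle := fun z => divConj (latticeCpx τ z) with hg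
  have himage : g '' primitiveSet τ φ T = ((hfin.toFinset.image g : Finset Circle) : Set Circle) := by
    simp
  rw [himage, finsum_mem_coe_finset, primitiveSum, tsum_eq_sum (s := hfin.toFinset)]
  · have h1 : ∀ z ∈ hfin.toFinset,
        (if content z = 1 then latticeTerm τ φ f T z else 0) = f (g z) := fun z hz => by
      have hz' := hfin.mem_toFinset.mp hz
      rw [if_pos hz'.1, latticeTerm, if_pos hz'.2]
    rw [Finset.sum_congr rfl h1, Finset.sum_comp, Finset.mul_sum]
    refine Finset.sum_congr rfl fun b hb => ?_
    obtain ⟨z, hz, rfl⟩ := Finset.mem_image.mp hb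
    have hz' := hfin.mem_toFinset.mp hz
    have hz0 : z ≠ -z := fun h => by
      have h0 : z = 0 := by
        ext
        · have := congrArg Prod.fst h
          simp only [Prod.fst_neg] at this
          simp only [Prod.fst_zero]
          omega
        · have := congrArg Prod.snd h
          simp only [Prod.snd_neg] at this
          simp only [Prod.snd_zero]
          omega
      have := hz'.1
      simp [h0, content] at this
    have h2 : {a ∈ hfin.toFinset | g a = g z} = {z, -z} := by
      ext w
      simp only [Finset.mem_filter, Set.Finite.mem_toFinset, Finset.mem_insert,
        Finset.mem_singleton]
      constructor
      · rintro ⟨hw, h⟩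
        exact eq_or_eq_neg_of_divConj_eq him hτ hz'.1 hw.1 h.symm
      · rintro (rfl | rfl)
        · exact ⟨hz', rfl⟩
        · refine ⟨⟨by rw [content_neg]; exact hz'.1, ?_⟩, ?_⟩
          · rw [hφ, latticeCpx_neg, norm_mul]
            simpa using hz'.2
          · simp only [hg]
            rw [latticeCpx_neg, divConj_ofReal_mul (by norm_num)]
    rw [h2, Finset.card_pair hz0]
    simp
  · intro z hz
    by_cases h : content z = 1
    · rw [if_pos h, latticeTerm, if_neg]
      exact fun h2 => hz (hfin.mem_toFinset.mpr ⟨h, h2⟩)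
    · rw [if_neg h]

theorem weilHeight_le_iff {K : Type*} [Field K] [NumberField K]
    [Algebra.IsQuadraticExtension ℚ K] (β : K) {t : ℝ} (ht : 0 ≤ t) :
    weilHeight β ≤ t ↔ Height.mulHeight₁ β ≤ t ^ 2 := by
  rw [weilHeight, Algebra.IsQuadraticExtension.finrank_eq_two, ← Real.sqrt_le_left ht,
    Real.sqrt_eq_rpow]
  norm_num

/-- Hilbert 90 for s gives β = x / s x; clearing denominators and dividing by the content makes x a
primitive lattice point. -/
theorem exists_content_eq_one_div_eq {K : Type*} [Field K] [NumberField K]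
    {s : K ≃ₐ[ℚ] K} {θ : K} (hθ0 : θ ≠ 0) (hs : s θ = -θ)
    (hgen : ∀ x : K, ∃ a b : ℚ, x = a + b * θ) {β : K} (hβ : β * s β = 1) :
    ∃ z : ℤ × ℤ, content z = 1 ∧ β = latticeElt θ z / latticeElt (-θ) z := by
  -- The usual choice x = 1 + β fails only at β = -1, where θ serves.
  obtain ⟨x, hx0, hx⟩ : ∃ x : K, x ≠ 0 ∧ β * s x = x := by
    by_cases h : 1 + β = 0
    · refine ⟨θ, hθ0, ?_⟩
      rw [hs, eq_neg_of_add_eq_zero_right h]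
      ring
    · refine ⟨1 + β, h, ?_⟩
      rw [map_add, map_one, mul_add, hβ]
      ring
  obtain ⟨a, b, hab⟩ := hgen x
  set y : ℤ × ℤ := (a.num * b.den, b.num * a.den) with hy
  have ha : (a.den : K) ≠ 0 := by exact_mod_cast a.den_ne_zero
  have hb : (b.den : K) ≠ 0 := by exact_mod_cast b.den_ne_zero
  have hyx : latticeElt θ y = a.den * b.den * x := by
    have h1 : (a : K) * a.den = a.num := by exact_mod_cast Rat.mul_den_eq_num a
    have h2 : (b : K) * b.den = b.num := by exact_mod_cast Rat.mul_den_eq_num b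
    rw [hab, latticeElt, hy]
    push_cast
    rw [← h1, ← h2]
    ring
  have hy0 : content y ≠ 0 := fun h => by
    rw [content_eq_zero_iff.mp h] at hyx
    simp [latticeElt, ha, hb, hx0] at hyx
  obtain ⟨z, hz⟩ := dvd_content_iff_exists.mp (dvd_refl (content y))
  have hz1 : content z = 1 := by
    have h := congrArg content hz
    rw [content_nsmul] at h
    exact (mul_eq_left₀ hy0).mp h
  refine ⟨z, hz1, ?_⟩
  have hc : (content y : K) ≠ 0 := by exact_mod_cast hy0
  have h3 : (content y : K) * latticeElt θ z = a.den * b.den * x := by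
    rw [← latticeElt_nsmul, hz, hyx]
  have h4 : s (latticeElt θ z) = latticeElt (-θ) z := by
    rw [← hs]
    exact map_latticeElt (s : K →+* K) θ z
  have h5 : latticeElt θ z ≠ 0 := fun h => by
    rw [h, mul_zero] at h3
    exact mul_ne_zero (mul_ne_zero ha hb) hx0 h3.symm
  rw [← h4, eq_div_iff ((map_ne_zero s).mpr h5)]
  refine mul_left_cancel₀ hc ?_
  have h6 := congrArg s h3
  simp only [map_mul, map_natCast] at h6
  calc (content y : K) * (β * s (latticeElt θ z))
      = β * (content y * s (latticeElt θ z)) := by ring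
    _ = a.den * b.den * (β * s x) := by rw [h6]; ring
    _ = _ := by rw [hx, h3]

section

variable {K : Type*} [Field K] [NumberField K] [Algebra.IsQuadraticExtension ℚ K]
  [IsTotallyComplex K]

/-- The single complex place has multiplicity 2 and gives the two conjugate coordinates the same
absolute value, hence the factor |z|². At finite places primitivity makes the truncation at 2d
ineffective. -/
theorem mulHeight₁_latticeElt_div (σ : K →+* ℂ) {θ : K} {d : ℕ} (hd : 0 < d)
    (hθ : θ ^ 2 = -(d : K)) {z : ℤ × ℤ} (hz : content z = 1) :
    Height.mulHeight₁ (latticeElt θ z / latticeElt (-θ) z) =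
      ‖latticeCpx (σ θ) z‖ ^ 2 * finiteFactor θ (2 * d) z := by
  have hτ : (σ θ) ^ 2 = -(d : ℂ) := by rw [← map_pow, hθ, map_neg, map_natCast]
  obtain ⟨him, hconj⟩ := conj_eq_neg_of_sq_eq_neg hd hτ
  have hz0 : z ≠ 0 := fun h => by simp [h, content] at hz
  have hσ : ∀ η : K, σ (latticeElt η z) = latticeCpx (σ η) z := fun η => map_latticeElt σ η z
  have hne : latticeElt θ z ≠ 0 := fun h => by
    refine latticeCpx_ne_zero him hz0 ?_
    rw [← hσ, h, map_zero]
  have hx : ![latticeElt θ z, latticeElt (-θ) z] ≠ 0 := fun h => hne (congrFun h 0)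
  have hcard : Fintype.card (InfinitePlace K) = 1 := by
    have h := InfinitePlace.sum_mult_eq (K := K)
    simp only [IsTotallyComplex.mult_eq, Finset.sum_const, Finset.card_univ, smul_eq_mul,
      Algebra.IsQuadraticExtension.finrank_eq_two ℚ K] at h
    omega
  have : Subsingleton (InfinitePlace K) := Fintype.card_le_one_iff_subsingleton.mp hcard.le
  have hsup : ∀ (F : K → ℝ), ⨆ i, F (![latticeElt θ z, latticeElt (-θ) z] i) =
      max (F (latticeElt θ z)) (F (latticeElt (-θ) z)) := fun F => by
    rw [← iSup_fin_two]
    refine iSup_congr fun i => ?_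
    fin_cases i <;> rfl
  rw [Height.mulHeight₁_div_eq_mulHeight, NumberField.mulHeight_eq hx,
    Fintype.prod_subsingleton _ (InfinitePlace.mk σ), IsTotallyComplex.mult_eq,
    hsup (InfinitePlace.mk σ), InfinitePlace.apply, InfinitePlace.apply, hσ, hσ, map_neg,
    ← conj_latticeCpx hconj, RCLike.norm_conj, max_self, finiteFactor]
  congr 1
  refine finprod_congr fun v => ?_
  rw [hsup v, localFactor, max_eq_left (le_max_apply_latticeElt hθ v hz)]

theorem image_normOneHeightLE_eq (σ : K →+* ℂ) {s : K ≃ₐ[ℚ] K} {θ : K} {d : ℕ} (hd : 0 < d)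
    (hθ : θ ^ 2 = -(d : K)) (hs : s θ = -θ) (hgen : ∀ x : K, ∃ a b : ℚ, x = a + b * θ)
    (hnorm : ∀ x : K, algebraMap ℚ K (Algebra.norm ℚ x) = x * s x) {t : ℝ} (ht : 0 ≤ t) :
    normOneToCircle σ '' normOneHeightLE K t = (fun z => divConj (latticeCpx (σ θ) z)) ''
      primitiveSet (σ θ) (finiteFactor θ (2 * d)) (t ^ 2) := by
  have hτ : (σ θ) ^ 2 = -(d : ℂ) := by rw [← map_pow, hθ, map_neg, map_natCast]
  obtain ⟨him, hconj⟩ := conj_eq_neg_of_sq_eq_neg hd hτ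
  have hσ : ∀ (η : K) z, σ (latticeElt η z) = latticeCpx (σ η) z := fun η z => map_latticeElt σ η z
  have hmem : ∀ β : K, β ∈ normOneSet K ↔ β * s β = 1 := fun β => by
    rw [← hnorm, ← (algebraMap ℚ K).map_one, (algebraMap ℚ K).injective.eq_iff]
    rfl
  have hθ0 : θ ≠ 0 := fun h => by simp [h] at him
  have hsz : ∀ z, s (latticeElt θ z) = latticeElt (-θ) z := fun z => by
    rw [← hs]
    exact map_latticeElt (s : K →+* K) θ z
  have hcircle : ∀ z, content z = 1 → ∀ hβ,
      normOneToCircle σ ⟨latticeElt θ z / latticeElt (-θ) z, hβ⟩ =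
        divConj (latticeCpx (σ θ) z) := fun z hz hβ => by
    have hz0 : z ≠ 0 := fun h => by simp [h, content] at hz
    ext
    rw [coe_divConj (latticeCpx_ne_zero him hz0), conj_latticeCpx hconj, ← map_neg, ← hσ, ← hσ,
      ← map_div₀]
    rfl
  ext b
  constructor
  · rintro ⟨⟨β, hβ⟩, hle, rfl⟩
    obtain ⟨z, hz, rfl⟩ := exists_content_eq_one_div_eq hθ0 hs hgen ((hmem β).mp hβ)
    refine ⟨z, ⟨hz, ?_⟩, (hcircle z hz hβ).symm⟩
    rw [← mulHeight₁_latticeElt_div σ hd hθ hz]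
    exact (weilHeight_le_iff _ ht).mp hle
  · rintro ⟨z, ⟨hz, hle⟩, rfl⟩
    have hz0 : z ≠ 0 := fun h => by simp [h, content] at hz
    have hne : latticeElt θ z ≠ 0 := fun h => by
      refine latticeCpx_ne_zero him hz0 ?_
      rw [← hσ, h, map_zero]
    have hne' : latticeElt (-θ) z ≠ 0 := by
      rw [← hsz]
      exact (map_ne_zero s).mpr hne
    have hss : s (latticeElt (-θ) z) = latticeElt θ z := by
      have h := map_latticeElt (s : K →+* K) (-θ) z
      simp only [RingHom.coe_coe, map_neg, hs, neg_neg] at h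
      exact h
    have hβ : latticeElt θ z / latticeElt (-θ) z ∈ normOneSet K := by
      rw [hmem, map_div₀, hss, hsz]
      field_simp
    refine ⟨⟨_, hβ⟩, ?_, hcircle z hz hβ⟩
    refine (weilHeight_le_iff _ ht).mpr ?_
    rwa [mulHeight₁_latticeElt_div σ hd hθ hz]

end

/-! ### Equidistribution. -/

theorem mainTheorem1 (K : Type*) [Field K] [NumberField K]
    [Algebra.IsQuadraticExtension ℚ K] [IsTotallyComplex K] (σ : K →+* ℂ) :
    IsEquidistributed (fun t : ℝ => normOneToCircle σ '' normOneHeightLE K t) := by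
  obtain ⟨s, θ, d, hd, hθ, hs, hgen, hnorm⟩ := exists_sqrt_neg_generator K
  have hτ : (σ θ) ^ 2 = -(d : ℂ) := by rw [← map_pow, hθ, map_neg, map_natCast]
  obtain ⟨him, hconj⟩ := conj_eq_neg_of_sq_eq_neg hd hτ
  have hvθ : ∀ v : FinitePlace K, v θ ≤ 1 := FinitePlace.apply_le_one_of_sq_eq_neg hθ
  set φ := finiteFactor θ (2 * d)
  have hM : 1 < 2 * d := by omega
  have : NeZero (2 * d) := ⟨by omega⟩
  have hper : LatticePeriodic (2 * d) φ := fun z q =>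
    finprod_congr fun v => latticePeriodic_localFactor (2 * d) (hvθ v) z q
  have hpos : ∀ z, 0 < φ z := finiteFactor_pos θ (by omega)
  have hmul : ∀ (m : ℕ) z, m.Coprime (2 * d) → φ (m • z) = φ z := fun m z hm =>
    finprod_congr fun v => localFactor_nsmul hm (hvθ v) z
  have hmono : Monotone fun t : ℝ => normOneToCircle σ '' normOneHeightLE K t := fun t t' h =>
    Set.image_mono fun β hβ => le_trans hβ h
  have himage : ∀ t : ℝ, 0 ≤ t → normOneToCircle σ '' normOneHeightLE K t =
      (fun z => divConj (latticeCpx (σ θ) z)) '' primitiveSet (σ θ) φ (t ^ 2) := fun t ht =>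
    image_normOneHeightLE_eq σ hd hθ hs hgen hnorm ht
  have hPfin : ∀ T, (primitiveSet (σ θ) φ T).Finite := fun T =>
    (finite_setOf_sq_norm_mul_le (σ θ) him hper hpos T).subset fun z hz => hz.2
  have hfin : ∀ t : ℝ, (normOneToCircle σ '' normOneHeightLE K t).Finite := fun t => by
    -- The parametrization by |z|² φ ≤ t² needs t ≥ 0; negative t is covered by monotonicity.
    refine Set.Finite.subset ?_ (hmono (le_max_left t 0))
    simp only [himage _ (le_max_right t 0)]
    exact (hPfin _).image _
  refine ⟨hmono, hfin, fun f => ?_⟩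
  obtain ⟨κ, hκ, hlim⟩ := exists_tendsto_primitiveSum (σ θ) him hM hper hpos hmul
  have hsq : Tendsto (fun t : ℝ => t ^ 2) atTop atTop := tendsto_pow_atTop two_ne_zero
  have hsum : ∀ (g : C(Circle, ℂ)) (t : ℝ), 0 ≤ t → primitiveSum (σ θ) φ g (t ^ 2) =
      2 * ∑ᶠ b ∈ normOneToCircle σ '' normOneHeightLE K t, g b := fun g t ht => by
    rw [himage t ht]
    exact primitiveSum_eq_two_mul_finsum him hconj (finiteFactor_neg θ (2 * d)) g (hPfin _)
  have hone : ∫ x, (1 : C(Circle, ℂ)) x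
      ∂Measure.haarMeasure (⊤ : TopologicalSpace.PositiveCompacts Circle) = 1 := by
    have h : Measure.haarMeasure (⊤ : TopologicalSpace.PositiveCompacts Circle) Set.univ = 1 :=
      Measure.haarMeasure_self
    simp [Measure.real, h]
  -- The sum for f = 1 counts the points, so κ, T and the factor 2 cancel in the quotient.
  have hquot := ((hlim f).comp hsq).div ((hlim 1).comp hsq) (by rw [hone, mul_one]; exact hκ)
  rw [hone, mul_one, mul_div_cancel_left₀ _ hκ] at hquot
  refine hquot.congr' ?_
  filter_upwards [eventually_gt_atTop 0] with t ht
  have ht2 : ((t ^ 2 : ℝ) : ℂ) ≠ 0 := by exact_mod_cast (pow_pos ht 2).ne'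
  have hcard : ∑ᶠ b ∈ normOneToCircle σ '' normOneHeightLE K t, (1 : C(Circle, ℂ)) b =
      ((normOneToCircle σ '' normOneHeightLE K t).ncard : ℂ) := by
    rw [finsum_mem_eq_finite_toFinset_sum _ (hfin t), Set.ncard_eq_toFinset_card _ (hfin t)]
    simp
  simp only [Pi.div_apply, Function.comp_apply]
  rw [mul_div_mul_left _ _ (inv_ne_zero ht2), hsum f t ht.le, hsum 1 t ht.le, hcard,
    mul_div_mul_left _ _ two_ne_zero, div_eq_inv_mul]
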